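/- For real $k\ge 0$ put $v_k=\pi^{k/2}/\Gamma(\tfrac k2+1)$, and let $\mathcal H^s$ denote the Hausdorff measure normalized by $v_s/2^s$, i.e. $\mathcal H^s(A)=\lim_{\delta\to0}\frac{v_s}{2^s}\inf\{\sum_i \operatorname{diam}(A_i)^s : A\subset\bigcup_i A_i,\ \operatorname{diam}(A_i)<\delta\}$ (so $\mathcal H^0$ is counting measure). Let $p\in[1,\infty)$ and let $q\in(1,\infty]$ be its dual exponent, $\frac1p+\frac1q=1$. Let $X$ be a compact metric space with $\mathcal H^N(X)<\infty$ for some real number $N\ge1$; the spaces $L^p(X)$, $L^q(X)$ and "almost everywhere" refer to $\mathcal H^N$. A Borel function $g:X\to[0,\infty]$ is an upper gradient of $f:X\to[-\infty,\infty]$ if $|f(\gamma(a))-f(\gamma(b))|\le\int_\gamma g\,ds$ for every non-constant rectifiable curve $\gamma:[a,b]\to X$ (with $|\infty-\infty|=\infty$), and a $p$-weak upper gradient if this holds for $p$-almost every such curve, i.e. outside a family of curves of $p$-modulus zero, where ${\rm Mod}_p(\Gamma)=\inf\int_X\rho^p\,d\mathcal H^N$ over all Borel $\rho:X\to[0,\infty]$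 with $\int_\gamma\rho\,ds\ge1$ for every rectifiable $\gamma\in\Gamma$. The Newtonian space $N^{1,p}(X)$ consists of the measurable functions $f:X\to[-\infty,\infty]$ in $L^p(X)$ that have an upper gradient in $L^p(X)$. A minimal $p$-weak upper gradient $|\nabla f|_p$ is a $p$-weak upper gradient in $L^p(X)$ that is almost everywhere at most every upper gradient of $f$ in $L^p(X)$. **Theorem.** Let $E,F\subset X$ be disjoint continua (non-empty, compact, connected sets), and let $u\in N^{1,p}(X)$ with $u=0$ on $E$ and $u=1$ on $F$. Then $u$ has a minimal $p$-weak upper gradient $|\nabla u|_p$, and there is a sequence of Lipschitz functions $u_i:X\to\mathbb R$ in $N^{1,p}(X)$ with $u_i=0$ on $E$ and $u_i=1$ on $F$ such that, for every Borel function $\rho:X\to[0,\infty]$ in $L^q(X)$, the functions $t\mapsto\int_{\partial\{u_i<t\}}\rho\,d\mathcal H^{N-1}$ are Lebesgue measurable on $[0,1]$ and $$\limsup_{i\to\infty}\int_0^1\int_{\partial\{u_i<t\}}\rho\,d\mathcal H^{N-1}\,dt\ \le\ \frac{2v_{N-1}}{v_N}\int_X\rho\,|\nabla u|_p\,d\mathcal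 H^N .$$ -/

import Mathlib

open MeasureTheory Set Filter
open scoped ENNReal Topology

noncomputable section

namespace Coarea

/-- `v_k = π^{k/2} / Γ(k/2 + 1)`, the volume of the unit ball of `ℝ^k` if `k` is an integer. -/
def ballVol (k : ℝ) : ℝ :=
  Real.pi ^ (k / 2) / Real.Gamma (k / 2 + 1)

/-- The Hausdorff measure `ℋ^s` with the normalization `v_s / 2^s`. Mathlib's `μH[s]` is
the unnormalized one, built from the sums `∑ diam(A_i)^s`. -/
def hausdorff {X : Type*} [EMetricSpace X] [MeasurableSpace X] [BorelSpace X] (s : ℝ) :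
    Measure X :=
  ENNReal.ofReal (ballVol s / 2 ^ s) • Measure.hausdorffMeasure s

/-- A curve in `X`: a continuous map from a compact non-empty interval `[left, right]` to `X`.
The values of `toFun` outside this interval play no role. -/
structure Curve (X : Type*) [TopologicalSpace X] where
  left : ℝ
  right : ℝ
  left_le_right : left ≤ right
  toFun : ℝ → X
  continuousOn : ContinuousOn toFun (Icc left right)

section Curves

variable {X : Type*} [MetricSpace X]

/-- The length of a curve. -/
def Curve.length (γ : Curve X) : ℝ≥0∞ :=
  eVariationOn γ.toFun (Icc γ.left γ.right)

/-- A curve is rectifiable if it has finite length. -/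
def Curve.Rectifiable (γ : Curve X) : Prop :=
  γ.length ≠ ∞

/-- The line integral `∫_γ g ds` along a rectifiable curve: the integral over `[0, length γ]` of
`g` composed with the arc-length parametrization of `γ`. -/
def Curve.lineIntegral (γ : Curve X) (g : X → ℝ≥0∞) : ℝ≥0∞ :=
  ∫⁻ s in Icc 0 γ.length.toReal,
    g (naturalParameterization γ.toFun (Icc γ.left γ.right) γ.left s)

/-- The upper gradient inequality `|f(γ(a)) - f(γ(b))| ≤ ∫_γ g ds` on one curve. In `EReal` one has
`⊤ - ⊤ = ⊥ - ⊥ = ⊥` and `EReal.abs ⊥ = ∞`, so that `|∞ - ∞| = ∞` is in force. -/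
def UpperGradientOn (f : X → EReal) (g : X → ℝ≥0∞) (γ : Curve X) : Prop :=
  (f (γ.toFun γ.left) - f (γ.toFun γ.right)).abs ≤ γ.lineIntegral g

/-- `g` is an upper gradient of `f`: it is Borel and the upper gradient inequality holds on every
rectifiable curve. As usual only non-constant curves are considered (those of length zero put no
condition at all on a function with finite values). -/
def IsUpperGradient [MeasurableSpace X] (f : X → EReal) (g : X → ℝ≥0∞) : Prop :=
  Measurable g ∧ ∀ γ : Curve X, γ.Rectifiable → γ.length ≠ 0 → UpperGradientOn f g γ

/-- `ρ` is admissible for the curve family `Γ`. -/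
def Admissible [MeasurableSpace X] (Γ : Set (Curve X)) (ρ : X → ℝ≥0∞) : Prop :=
  Measurable ρ ∧ ∀ γ ∈ Γ, γ.Rectifiable → 1 ≤ γ.lineIntegral ρ

variable [MeasurableSpace X] [BorelSpace X]

/-- The `p`-modulus of a curve family with respect to `ℋ^N`, for `1 ≤ p < ∞`. -/
def modulus (N p : ℝ) (Γ : Set (Curve X)) : ℝ≥0∞ :=
  ⨅ (ρ : X → ℝ≥0∞) (_ : Admissible Γ ρ), ∫⁻ x, ρ x ^ p ∂(hausdorff N)

/-- `g` is a `p`-weak upper gradient of `f`: it is Borel and the upper gradient inequality holds on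
`p`-almost every (non-constant rectifiable) curve. -/
def IsWeakUpperGradient (N p : ℝ) (f : X → EReal) (g : X → ℝ≥0∞) : Prop :=
  Measurable g ∧
    modulus N p {γ : Curve X | γ.Rectifiable ∧ γ.length ≠ 0 ∧ ¬ UpperGradientOn f g γ} = 0

/-- The Newtonian space `N^{1,p}(X)` for `1 ≤ p < ∞`: functions in `L^p(X)` that have an upper
gradient in `L^p(X)`; the measure is `ℋ^N`. -/
def MemNewtonian (N p : ℝ) (f : X → EReal) : Prop :=
  AEMeasurable f (hausdorff N) ∧ ∫⁻ x, (f x).abs ^ p ∂(hausdorff N) < ∞ ∧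
    ∃ g : X → ℝ≥0∞, IsUpperGradient f g ∧ ∫⁻ x, g x ^ p ∂(hausdorff N) < ∞

/-- `g` is (a representative of) the minimal `p`-weak upper gradient `|∇f|_p` of `f`: a `p`-weak
upper gradient in `L^p(X)` that is almost everywhere at most any upper gradient in `L^p(X)`.
Representatives agree almost everywhere. -/
def IsMinimalWeakUpperGradient (N p : ℝ) (f : X → EReal) (g : X → ℝ≥0∞) : Prop :=
  IsWeakUpperGradient N p f g ∧ ∫⁻ x, g x ^ p ∂(hausdorff N) < ∞ ∧
    ∀ h : X → ℝ≥0∞, IsUpperGradient f h → ∫⁻ x, h x ^ p ∂(hausdorff N) < ∞ →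
      g ≤ᵐ[hausdorff N] h

end Curves

end Coarea

end

/-! The minimal weak upper gradient is the infimum of a sequence of upper gradients minimizing the
`L^p` norm. Along a curve on which all of them are integrable, `u` is absolutely continuous in arc
length and its derivative is bounded almost everywhere by each of them, hence by the infimum `g`
(`ofReal_abs_sub_le_lintegral_iInf`). A single `σ` in `L^p` controls the exceptional curves, so `g +
ε σ` is a genuine upper gradient for every `ε > 0`.

By Vitali-Carathéodory, `g + ε σ + ε` lies below a lower semicontinuous `h` that is close in `L^p`.
Every curve from `E` to `F` has `h`-length at least `1`. The `h`-distance from `E` need not be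
Lipschitz, as `X` may have few curves. It is therefore replaced by a distance along coarse curves
that may jump by `r`, weighted by a Lipschitz minorant of `h` (`coarseDist`). Any two points at
distance at most `r` are then joined cheaply, which gives a Lipschitz function. As the scale shrinks
and the minorants increase, cheap coarse curves from `E` to `F` would converge to a genuine curve of
`h`-length less than `1`, so the coarse distance between `E` and `F` is eventually almost `1`
(`exists_le_coarseDist`). Truncating and rescaling yields the approximating function, whose local
Lipschitz constant is at most a continuous `φ`, with `φ ≤ (1 + ε) h`.

Eilenberg's inequality on sets where `φ ≤ c` bounds the measure obtained by integrating `ℋ^{N-1}`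
over level sets by `φ ℋ^N`, up to the normalizing constant (`coarea_frontier_le`). Since `∂{f < t}`
lies in the level set `f = t`, the coarea inequality follows with `φ` on the right. Hölder's
inequality with `ρ` in `L^q` removes the errors as `ε → 0`. -/

noncomputable section

namespace Coarea

/-! ### Arc length and line integrals -/

section NaturalParametrization

variable {X : Type*} [MetricSpace X]

/-- The variation of a continuous function of locally bounded variation is continuous. -/
theorem continuousOn_variationOnFromTo {f : ℝ → X} {s : Set ℝ}
    (hf : LocallyBoundedVariationOn f s) (hc : ContinuousOn f s) {a : ℝ} (ha : a ∈ s) :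
    ContinuousOn (variationOnFromTo f s a) s := by
  intro b hb
  -- The variation jumps at `b` by the distance from `f b` to the one-sided limit of `f`, which is
  -- `f b` itself by continuity.
  have hl := variationOnFromTo.tendsto_left (l := f b) ha hb hf
    ((hc b hb).mono inter_subset_left)
  have hr := variationOnFromTo.tendsto_right (l := f b) ha hb hf
    ((hc b hb).mono inter_subset_left)
  simp only [dist_self, sub_zero, add_zero] at hl hr
  have hs : s ⊆ (s ∩ Iio b ∪ s ∩ Ioi b) ∪ {b} := by
    intro x hx
    rcases lt_trichotomy x b with h | h | h
    · exact Or.inl (Or.inl ⟨hx, h⟩)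
    · exact Or.inr h
    · exact Or.inl (Or.inr ⟨hx, h⟩)
  refine ContinuousWithinAt.mono ?_ hs
  refine ContinuousWithinAt.union (ContinuousWithinAt.union hl hr) ?_
  exact continuousWithinAt_singleton

namespace Curve

variable (γ : Curve X)

/-- The arc-length parametrization of a curve, meaningful on `[0, length γ]`. -/
def arc : ℝ → X := naturalParameterization γ.toFun (Icc γ.left γ.right) γ.left

/-- The length of `γ` up to time `t`. -/
def lengthTo (t : ℝ) : ℝ := variationOnFromTo γ.toFun (Icc γ.left γ.right) γ.left t

theorem left_mem : γ.left ∈ Icc γ.left γ.right := left_mem_Icc.2 γ.left_le_right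

theorem right_mem : γ.right ∈ Icc γ.left γ.right := right_mem_Icc.2 γ.left_le_right

theorem lineIntegral_eq (g : X → ℝ≥0∞) :
    γ.lineIntegral g = ∫⁻ s in Icc 0 γ.length.toReal, g (γ.arc s) := rfl

theorem lineIntegral_mono {g h : X → ℝ≥0∞} (hgh : ∀ x, g x ≤ h x) :
    γ.lineIntegral g ≤ γ.lineIntegral h :=
  lintegral_mono fun _ => hgh _

theorem lengthTo_left : γ.lengthTo γ.left = 0 := variationOnFromTo.self _ _ _

theorem lengthTo_right : γ.lengthTo γ.right = γ.length.toReal := by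
  rw [lengthTo, variationOnFromTo.eq_of_le _ _ γ.left_le_right, inter_self, length]

variable {γ}

theorem Rectifiable.locallyBoundedVariationOn (hγ : γ.Rectifiable) :
    LocallyBoundedVariationOn γ.toFun (Icc γ.left γ.right) :=
  BoundedVariationOn.locallyBoundedVariationOn hγ

theorem Rectifiable.lengthTo_monotoneOn (hγ : γ.Rectifiable) :
    MonotoneOn γ.lengthTo (Icc γ.left γ.right) :=
  variationOnFromTo.monotoneOn hγ.locallyBoundedVariationOn γ.left_mem

theorem Rectifiable.image_lengthTo (hγ : γ.Rectifiable) :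
    γ.lengthTo '' Icc γ.left γ.right = Icc 0 γ.length.toReal := by
  have hc : ContinuousOn γ.lengthTo (Icc γ.left γ.right) :=
    continuousOn_variationOnFromTo hγ.locallyBoundedVariationOn γ.continuousOn γ.left_mem
  apply Subset.antisymm
  · rintro _ ⟨t, ht, rfl⟩
    rw [← γ.lengthTo_left, ← γ.lengthTo_right]
    exact ⟨hγ.lengthTo_monotoneOn γ.left_mem ht ht.1, hγ.lengthTo_monotoneOn ht γ.right_mem ht.2⟩
  · rw [← γ.lengthTo_left, ← γ.lengthTo_right]
    exact intermediate_value_Icc γ.left_le_right hc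

theorem Rectifiable.arc_lengthTo (hγ : γ.Rectifiable) {t : ℝ} (ht : t ∈ Icc γ.left γ.right) :
    γ.arc (γ.lengthTo t) = γ.toFun t :=
  edist_eq_zero.1
    (edist_naturalParameterization_eq_zero hγ.locallyBoundedVariationOn γ.left_mem ht)

theorem Rectifiable.arc_zero (hγ : γ.Rectifiable) : γ.arc 0 = γ.toFun γ.left := by
  rw [← γ.lengthTo_left, hγ.arc_lengthTo γ.left_mem]

theorem Rectifiable.arc_length (hγ : γ.Rectifiable) :
    γ.arc γ.length.toReal = γ.toFun γ.right := by
  rw [← γ.lengthTo_right, hγ.arc_lengthTo γ.right_mem]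

theorem Rectifiable.hasUnitSpeedOn_arc (hγ : γ.Rectifiable) :
    HasUnitSpeedOn γ.arc (Icc 0 γ.length.toReal) := by
  rw [← hγ.image_lengthTo]
  exact has_unit_speed_naturalParameterization _ hγ.locallyBoundedVariationOn γ.left_mem

end Curve

theorem HasUnitSpeedOn.lipschitzOnWith {c : ℝ → X} {s : Set ℝ} (hc : HasUnitSpeedOn c s) :
    LipschitzOnWith 1 c s := by
  have key : ∀ x ∈ s, ∀ y ∈ s, x ≤ y → edist (c x) (c y) ≤ edist x y := by
    intro x hx y hy hxy
    have h1 := hc hx hy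
    have h2 : edist (c x) (c y) ≤ eVariationOn c (s ∩ Icc x y) :=
      eVariationOn.edist_le c ⟨hx, le_rfl, hxy⟩ ⟨hy, hxy, le_rfl⟩
    refine h2.trans ?_
    rw [h1, edist_comm, edist_dist, Real.dist_eq, abs_of_nonneg (sub_nonneg.2 hxy)]
    simp
  intro x hx y hy
  rw [ENNReal.coe_one, one_mul]
  rcases le_total x y with h | h
  · exact key x hx y hy h
  · rw [edist_comm, edist_comm x y]
    exact key y hy x hx h

/-- A curve of unit speed is its own arc-length parametrization up to translation. -/
theorem lineIntegral_of_hasUnitSpeedOn {γ : Curve X}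
    (h : HasUnitSpeedOn γ.toFun (Icc γ.left γ.right)) (g : X → ℝ≥0∞) :
    γ.length = ENNReal.ofReal (γ.right - γ.left) ∧
    γ.lineIntegral g = ∫⁻ t in Icc γ.left γ.right, g (γ.toFun t) := by
  have hlen : γ.length = ENNReal.ofReal (γ.right - γ.left) := by
    have := h γ.left_mem γ.right_mem
    rwa [inter_self, NNReal.coe_one, one_mul] at this
  have hrect : γ.Rectifiable := by rw [Curve.Rectifiable, hlen]; exact ENNReal.ofReal_ne_top
  refine ⟨hlen, ?_⟩
  have hL : γ.length.toReal = γ.right - γ.left := by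
    rw [hlen, ENNReal.toReal_ofReal (sub_nonneg.2 γ.left_le_right)]
  have hto : ∀ t ∈ Icc γ.left γ.right, γ.lengthTo t = t - γ.left := by
    intro t ht
    have := (hasConstantSpeedOnWith_iff_variationOnFromTo_eq.1 h).2 γ.left_mem ht
    rwa [NNReal.coe_one, one_mul] at this
  have hmp : MeasurePreserving (fun t : ℝ => t - γ.left) volume volume :=
    measurePreserving_sub_right volume γ.left
  have hpre : (fun t : ℝ => t - γ.left) ⁻¹' Icc 0 (γ.length.toReal) = Icc γ.left γ.right := by
    ext t; simp [hL]
  rw [γ.lineIntegral_eq, ← hmp.setLIntegral_comp_preimage_emb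
    (MeasurableEquiv.subRight γ.left).measurableEmbedding, hpre]
  refine setLIntegral_congr_fun measurableSet_Icc fun t ht => ?_
  rw [← hto t ht, hrect.arc_lengthTo ht]

/-- The restriction of the arc-length parametrization of `γ` to `[s, t]`. -/
def Curve.sub (γ : Curve X) (hγ : γ.Rectifiable) {s t : ℝ} (hs : 0 ≤ s) (hst : s ≤ t)
    (ht : t ≤ γ.length.toReal) : Curve X where
  left := s
  right := t
  left_le_right := hst
  toFun := γ.arc
  continuousOn := (HasUnitSpeedOn.lipschitzOnWith hγ.hasUnitSpeedOn_arc).continuousOn.mono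
    (Icc_subset_Icc hs ht)

theorem Curve.sub_spec (γ : Curve X) (hγ : γ.Rectifiable) {s t : ℝ} (hs : 0 ≤ s) (hst : s ≤ t)
    (ht : t ≤ γ.length.toReal) (g : X → ℝ≥0∞) :
    (γ.sub hγ hs hst ht).length = ENNReal.ofReal (t - s) ∧
    (γ.sub hγ hs hst ht).lineIntegral g = ∫⁻ x in Icc s t, g (γ.arc x) := by
  apply lineIntegral_of_hasUnitSpeedOn
  intro x hx y hy
  have h := hγ.hasUnitSpeedOn_arc (Icc_subset_Icc hs ht hx) (Icc_subset_Icc hs ht hy)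
  have e : ∀ {u v : ℝ}, x ∈ Icc u v → y ∈ Icc u v → Icc u v ∩ Icc x y = Icc x y := by
    intro u v hx hy
    exact inter_eq_right.2 (Icc_subset_Icc hx.1 hy.2)
  rw [e (Icc_subset_Icc hs ht hx) (Icc_subset_Icc hs ht hy)] at h
  change eVariationOn γ.arc (Icc s t ∩ Icc x y) = _
  rw [e (u := s) (v := t) hx hy, h]

theorem Curve.Rectifiable.aemeasurable_comp_arc [MeasurableSpace X] [BorelSpace X] {γ : Curve X}
    (hγ : γ.Rectifiable) {g : X → ℝ≥0∞} (hg : Measurable g) :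
    AEMeasurable (fun s => g (γ.arc s)) (volume.restrict (Icc 0 γ.length.toReal)) :=
  hg.comp_aemeasurable
    ((HasUnitSpeedOn.lipschitzOnWith hγ.hasUnitSpeedOn_arc).continuousOn.aemeasurable
      measurableSet_Icc)

theorem lineIntegral_const {γ : Curve X} (hγ : γ.Rectifiable) (c : ℝ≥0∞) :
    γ.lineIntegral (fun _ => c) = c * γ.length := by
  rw [γ.lineIntegral_eq, setLIntegral_const, Real.volume_Icc, sub_zero, ENNReal.ofReal_toReal hγ]

/-- A Lipschitz curve is rectifiable, and line integrals along it are controlled by integrals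
with respect to the parameter. -/
theorem lineIntegral_le_of_lipschitzOnWith {γ : Curve X} {K : NNReal}
    (hK : LipschitzOnWith K γ.toFun (Icc γ.left γ.right)) :
    γ.Rectifiable ∧ ∀ g : X → ℝ≥0∞,
      γ.lineIntegral g ≤ K * ∫⁻ t in Icc γ.left γ.right, g (γ.toFun t) := by
  have hvar : ∀ x y : ℝ, Icc x y ⊆ Icc γ.left γ.right →
      eVariationOn γ.toFun (Icc x y) ≤ K * ENNReal.ofReal (y - x) := by
    intro x y hxy
    have := (hK.mono hxy).comp_eVariationOn_le (f := γ.toFun) (g := (id : ℝ → ℝ)) (s := Icc x y)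
      (mapsTo_id _)
    rwa [eVariationOn_id_Icc] at this
  have hγ : γ.Rectifiable :=
    ne_top_of_le_ne_top (ENNReal.mul_ne_top ENNReal.coe_ne_top ENNReal.ofReal_ne_top)
      (hvar _ _ Subset.rfl)
  refine ⟨hγ, fun g => ?_⟩
  have hle : ∀ x ∈ Icc γ.left γ.right, ∀ y ∈ Icc γ.left γ.right, x ≤ y →
      edist (γ.lengthTo x) (γ.lengthTo y) ≤ K * edist x y := by
    intro x hx y hy hxy
    have hadd := variationOnFromTo.add hγ.locallyBoundedVariationOn γ.left_mem hx hy
    rw [variationOnFromTo.eq_of_le _ _ hxy, inter_eq_right.2 (Icc_subset_Icc hx.1 hy.2)] at hadd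
    have h1 : dist (γ.lengthTo x) (γ.lengthTo y) = (eVariationOn γ.toFun (Icc x y)).toReal := by
      rw [dist_comm, Real.dist_eq, Curve.lengthTo, Curve.lengthTo, ← hadd, add_sub_cancel_left,
        abs_of_nonneg ENNReal.toReal_nonneg]
    rw [edist_dist, h1]
    refine ENNReal.ofReal_toReal_le.trans ((hvar x y (Icc_subset_Icc hx.1 hy.2)).trans ?_)
    rw [edist_comm, edist_dist, Real.dist_eq, abs_of_nonneg (sub_nonneg.2 hxy)]
  have hlip : LipschitzOnWith K γ.lengthTo (Icc γ.left γ.right) := by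
    intro x hx y hy
    rcases le_total x y with h | h
    · exact hle x hx y hy h
    · rw [edist_comm, edist_comm x y]
      exact hle y hy x hx h
  have hVm : AEMeasurable γ.lengthTo (volume.restrict (Icc γ.left γ.right)) :=
    hlip.continuousOn.aemeasurable measurableSet_Icc
  -- The arc-length function is `K`-Lipschitz and maps onto `[0, length γ]`, so Lebesgue measure
  -- there is at most `K` times the image of Lebesgue measure on the parameter interval.
  have hμ : volume.restrict (Icc 0 γ.length.toReal) ≤
      (K : ℝ≥0∞) • (volume.restrict (Icc γ.left γ.right)).map γ.lengthTo := by
    refine Measure.le_iff.2 fun B hB => ?_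
    rw [Measure.restrict_apply hB, Measure.smul_apply, Measure.map_apply_of_aemeasurable hVm hB,
      Measure.restrict_apply' measurableSet_Icc, smul_eq_mul, inter_comm, ← hγ.image_lengthTo,
      ← image_inter_preimage, inter_comm, ← hausdorffMeasure_real]
    simpa using (hlip.mono inter_subset_right).hausdorffMeasure_image_le (zero_le_one' ℝ)
  rw [γ.lineIntegral_eq]
  refine (lintegral_mono' hμ le_rfl).trans ?_
  rw [lintegral_smul_measure, smul_eq_mul]
  refine mul_le_mul_right ((lintegral_map_le _ _).trans (le_of_eq ?_)) _
  refine setLIntegral_congr_fun measurableSet_Icc fun t ht => ?_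
  rw [hγ.arc_lengthTo ht]

end NaturalParametrization

/-! ### Infima of upper gradients along a curve -/

section Infimum

/-- If the increments of `F` are bounded by the integrals of each of countably many functions, then
they are bounded by the integral of their infimum. -/
theorem ofReal_abs_sub_le_lintegral_iInf {ι : Type*} [Countable ι] [Nonempty ι] {F : ℝ → ℝ}
    {a b : ℝ} (hab : a ≤ b) {h : ι → ℝ → ℝ≥0∞}
    (hm : ∀ i, AEMeasurable (h i) (volume.restrict (Icc a b)))
    (hfin : ∀ i, ∫⁻ x in Icc a b, h i x ≠ ∞)
    (hF : ∀ i, ∀ s t, a ≤ s → s < t → t ≤ b →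
      ENNReal.ofReal |F s - F t| ≤ ∫⁻ x in Icc s t, h i x) :
    ENNReal.ofReal |F a - F b| ≤ ∫⁻ x in Icc a b, ⨅ i, h i x := by
  have hint : ∀ i, IntervalIntegrable (fun x => (h i x).toReal) volume a b := fun i => by
    rw [intervalIntegrable_iff_integrableOn_Icc_of_le hab]
    exact integrable_toReal_of_lintegral_ne_top (hm i) (hfin i)
  have huIcc : uIcc a b = Icc a b := uIcc_of_le hab
  have hlt : ∀ i, ∀ᵐ x ∂volume.restrict (Icc a b), h i x < ∞ := fun i =>
    ae_lt_top' (hm i) (hfin i)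
  have hset : ∀ i, ∀ s t, a ≤ s → s ≤ t → t ≤ b →
      ∫⁻ x in Icc s t, h i x = ENNReal.ofReal (∫ x in s..t, (h i x).toReal) := by
    intro i s t hs hst ht
    have hsub := Icc_subset_Icc hs ht
    rw [intervalIntegral.integral_of_le hst, ← integral_Icc_eq_integral_Ioc,
      integral_toReal ((hm i).mono_set hsub) (ae_restrict_of_ae_restrict_of_subset hsub (hlt i)),
      ENNReal.ofReal_toReal (ne_top_of_le_ne_top (hfin i) (lintegral_mono_set hsub))]
  have hle : ∀ i, ∀ s ∈ Icc a b, ∀ t ∈ Icc a b,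
      |F s - F t| ≤ |(∫ x in a..s, (h i x).toReal) - ∫ x in a..t, (h i x).toReal| := by
    intro i
    have key : ∀ s ∈ Icc a b, ∀ t ∈ Icc a b, s ≤ t →
        |F s - F t| ≤ |(∫ x in a..s, (h i x).toReal) - ∫ x in a..t, (h i x).toReal| := by
      intro s hs t ht hst
      rcases hst.eq_or_lt with rfl | hst'
      · simp
      have h1 := hF i s t hs.1 hst' ht.2
      have hnn : 0 ≤ ∫ x in s..t, (h i x).toReal :=
        intervalIntegral.integral_nonneg hst fun _ _ => ENNReal.toReal_nonneg
      rw [hset i s t hs.1 hst ht.2, ENNReal.ofReal_le_ofReal_iff hnn] at h1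
      have has : IntervalIntegrable (fun x => (h i x).toReal) volume a s :=
        (hint i).mono_set (by rw [huIcc, uIcc_of_le hs.1]; exact Icc_subset_Icc le_rfl hs.2)
      have hat : IntervalIntegrable (fun x => (h i x).toReal) volume a t :=
        (hint i).mono_set (by rw [huIcc, uIcc_of_le ht.1]; exact Icc_subset_Icc le_rfl ht.2)
      rw [abs_sub_comm (∫ x in a..s, _), intervalIntegral.integral_interval_sub_left hat has,
        abs_of_nonneg hnn]
      exact h1
    intro s hs t ht
    rcases le_total s t with h' | h'
    · exact key s hs t ht h'
    · rw [abs_sub_comm, abs_sub_comm (∫ x in a..s, _)]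
      exact key t ht s hs h'
  obtain ⟨i₀⟩ := ‹Nonempty ι›
  -- Increments of `F` are dominated by those of the primitive of `h i₀`, from which absolute
  -- continuity is inherited.
  have hac : AbsolutelyContinuousOnInterval F a b := by
    have h1 := (hint i₀).absolutelyContinuousOnInterval_intervalIntegral (c := a) left_mem_uIcc
    rw [absolutelyContinuousOnInterval_iff] at h1 ⊢
    intro ε hε
    obtain ⟨δ, hδ, h2⟩ := h1 ε hε
    refine ⟨δ, hδ, fun E hE hsum => lt_of_le_of_lt (Finset.sum_le_sum fun k hk => ?_)
      (h2 E hE hsum)⟩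
    obtain ⟨h3, h4⟩ := hE.1 k hk
    rw [huIcc] at h3 h4
    exact hle i₀ _ h3 _ h4
  -- Difference quotients of `F` are dominated by those of the primitive of `h i`, which converge to
  -- `h i x` at almost every interior point.
  have hder : ∀ i, ∀ᵐ x, x ∈ uIcc a b → |deriv F x| ≤ (h i x).toReal := by
    intro i
    have hne : ∀ c : ℝ, ∀ᵐ x : ℝ, x ≠ c := fun c => by simp [ae_iff, measure_singleton]
    filter_upwards [hac.ae_differentiableAt, (hint i).ae_hasDerivAt_integral, hne a, hne b]
      with x hx₁ hx₂ hxa hxb hx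
    have d1 := (hx₁ hx).hasDerivAt.tendsto_slope.norm
    have d2 := (hx₂ hx a left_mem_uIcc).tendsto_slope.norm
    rw [Real.norm_of_nonneg ENNReal.toReal_nonneg] at d2
    refine le_of_tendsto_of_tendsto d1 d2 ?_
    rw [huIcc] at hx
    have hnb : Icc a b ∈ 𝓝 x :=
      Icc_mem_nhds (lt_of_le_of_ne hx.1 hxa.symm) (lt_of_le_of_ne hx.2 hxb)
    filter_upwards [mem_nhdsWithin_of_mem_nhds hnb] with y hy
    rw [slope_def_field, slope_def_field, norm_div, norm_div]
    exact div_le_div_of_nonneg_right (hle i y hy x hx) (norm_nonneg _)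
  have hFTC := hac.integral_deriv_eq_sub
  have hbound : ENNReal.ofReal |F a - F b| ≤ ∫⁻ x in Icc a b, ENNReal.ofReal |deriv F x| := by
    rw [abs_sub_comm, ← hFTC, intervalIntegral.integral_of_le hab, ← integral_Icc_eq_integral_Ioc]
    simpa only [Real.enorm_eq_ofReal_abs] using
      enorm_integral_le_lintegral_enorm (μ := volume.restrict (Icc a b)) (deriv F)
  refine hbound.trans (lintegral_mono_ae ?_)
  have hder' := ae_all_iff.2 hder
  filter_upwards [ae_restrict_of_ae hder', ae_restrict_mem measurableSet_Icc] with x hx hxm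
  refine le_iInf fun i => ?_
  exact (ENNReal.ofReal_le_ofReal (hx i (by rwa [huIcc]))).trans ENNReal.ofReal_toReal_le

/-- Differences of equal infinities have absolute value `∞`, so a finite difference forces both
values to be real. Hence `u` can be treated as a real function along a curve with an integrable
upper gradient. -/
theorem EReal_abs_sub_eq {x y : EReal} (h : (x - y).abs ≠ ∞) :
    (x - y).abs = ENNReal.ofReal |x.toReal - y.toReal| := by
  induction x <;> induction y <;>
    simp_all [EReal.abs_def, EReal.abs_top, EReal.abs_bot, ← EReal.coe_sub]

variable {X : Type*} [MetricSpace X] [MeasurableSpace X] [BorelSpace X]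

/-- The infimum of countably many upper gradients satisfies the upper gradient inequality on all
curves along which each of them is integrable. -/
theorem upperGradientOn_iInf {ι : Type*} [Countable ι] [Nonempty ι] {u : X → EReal}
    {h : ι → X → ℝ≥0∞} (hh : ∀ i, IsUpperGradient u (h i)) {γ : Curve X} (hγ : γ.Rectifiable)
    (hγ0 : γ.length ≠ 0) (hfin : ∀ i, γ.lineIntegral (h i) ≠ ∞) :
    UpperGradientOn u (fun x => ⨅ i, h i x) γ := by
  have hineq : ∀ i, ∀ s t, 0 ≤ s → s < t → t ≤ γ.length.toReal →
      (u (γ.arc s) - u (γ.arc t)).abs ≤ ∫⁻ x in Icc s t, h i (γ.arc x) := by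
    intro i s t hs hst ht
    have hspec := γ.sub_spec hγ hs hst.le ht (h i)
    have := (hh i).2 (γ.sub hγ hs hst.le ht)
      (by rw [Curve.Rectifiable, hspec.1]; exact ENNReal.ofReal_ne_top)
      (by rw [hspec.1]; simpa using hst)
    rw [UpperGradientOn, hspec.2] at this
    exact this
  have hfin' : ∀ i, ∀ s t, 0 ≤ s → t ≤ γ.length.toReal →
      ∫⁻ x in Icc s t, h i (γ.arc x) ≠ ∞ := fun i s t hs ht =>
    ne_top_of_le_ne_top (hfin i) (lintegral_mono_set (Icc_subset_Icc hs ht))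
  obtain ⟨i₀⟩ := ‹Nonempty ι›
  have hreal : ∀ s t, 0 ≤ s → s < t → t ≤ γ.length.toReal → (u (γ.arc s) - u (γ.arc t)).abs =
      ENNReal.ofReal |(u (γ.arc s)).toReal - (u (γ.arc t)).toReal| := fun s t hs hst ht =>
    EReal_abs_sub_eq (ne_top_of_le_ne_top (hfin' i₀ s t hs ht) (hineq i₀ s t hs hst ht))
  have hL : 0 < γ.length.toReal := ENNReal.toReal_pos hγ0 hγ
  rw [UpperGradientOn, ← hγ.arc_zero, ← hγ.arc_length, hreal 0 _ le_rfl hL le_rfl,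
    γ.lineIntegral_eq]
  have : Nonempty ι := ⟨i₀⟩
  refine ofReal_abs_sub_le_lintegral_iInf (F := fun s => (u (γ.arc s)).toReal) hL.le
    (fun i => hγ.aemeasurable_comp_arc (hh i).1) (fun i => hfin' i _ _ le_rfl le_rfl) ?_
  intro i s t hs hst ht
  rw [← hreal s t hs hst ht]
  exact hineq i s t hs hst ht

end Infimum

/-! ### Countable essential infima in `L^p` -/

section EssentialInfimum

variable {α : Type*} [MeasurableSpace α] {μ : Measure α} {p : ℝ}

/-- A family of functions in `L^p` has a countable subfamily whose infimum is almost everywhere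
below each member of the family. -/
theorem exists_seq_iInf_ae_le (hp : 0 < p) {G : Set (α → ℝ≥0∞)} (hne : G.Nonempty)
    (hG : ∀ h ∈ G, Measurable h ∧ ∫⁻ x, h x ^ p ∂μ < ∞) :
    ∃ h : ℕ → α → ℝ≥0∞, (∀ n, h n ∈ G) ∧ ∀ k ∈ G, (fun x => ⨅ n, h n x) ≤ᵐ[μ] k := by
  obtain ⟨h₀, hh₀⟩ := hne
  let Φ : (ℕ → G) → ℝ≥0∞ := fun h => ∫⁻ x, (⨅ n, (h n : α → ℝ≥0∞) x) ^ p ∂μ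
  let J : ℝ≥0∞ := ⨅ h, Φ h
  have : Nonempty (ℕ → G) := ⟨fun _ => ⟨h₀, hh₀⟩⟩
  obtain ⟨v, -, hv, hvm⟩ := exists_seq_tendsto_sInf (S := range Φ) (range_nonempty Φ) ⟨0, by
    intro; simp⟩
  choose H hH using hvm
  -- Merging countably many sequences into one by the pairing function turns a minimizing sequence
  -- for `Φ` into a minimizer.
  let h : ℕ → G := fun n => H n.unpair.1 n.unpair.2
  have hΦ : Φ h ≤ J := by
    refine ge_of_tendsto' hv fun k => ?_
    rw [← hH k]
    refine lintegral_mono fun x => ENNReal.rpow_le_rpow ?_ hp.le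
    refine le_iInf fun n => (iInf_le _ (Nat.pair k n)).trans ?_
    simp [h]
  have hfin : Φ h ≠ ∞ := by
    refine ne_top_of_le_ne_top (hG _ (h 0).2).2.ne (lintegral_mono fun x => ?_)
    exact ENNReal.rpow_le_rpow (iInf_le _ 0) hp.le
  refine ⟨fun n => h n, fun n => (h n).2, fun k hk => ?_⟩
  -- Prepending `k` cannot lower the minimal finite integral, so the two infima agree almost
  -- everywhere.
  let h' : ℕ → G := fun n => Nat.casesOn n ⟨k, hk⟩ h
  have hinf : ∀ x, (⨅ n : ℕ, (h' n).1 x) = k x ⊓ ⨅ n, (h n : α → ℝ≥0∞) x := by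
    intro x
    rw [← inf_iInf_nat_succ (fun n : ℕ => (h' n).1 x)]
    rfl
  have hm : Measurable fun x => ⨅ n, (h n : α → ℝ≥0∞) x :=
    Measurable.iInf fun n => (hG _ (h n).2).1
  have hle : Φ h ≤ Φ h' := hΦ.trans (iInf_le _ _)
  have hae := ae_eq_of_ae_le_of_lintegral_le (μ := μ)
    (f := fun x => (⨅ n : ℕ, (h' n).1 x) ^ p) (g := fun x => (⨅ n, (h n : α → ℝ≥0∞) x) ^ p)
    (Eventually.of_forall fun x => by
      simp only [hinf]; exact ENNReal.rpow_le_rpow inf_le_right hp.le)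
    (ne_top_of_le_ne_top hfin (lintegral_mono fun x => by
      simp only [hinf]; exact ENNReal.rpow_le_rpow inf_le_right hp.le))
    (hm.pow_const p).aemeasurable hle
  filter_upwards [hae] with x hx
  have := ENNReal.rpow_left_injective hp.ne' hx
  rw [hinf] at this
  rw [← this]
  exact inf_le_left

/-- Countably many functions in `L^p` have a common bound in `L^p`, up to constants. -/
theorem exists_lintegral_rpow_lt_top_of_seq (hp : 0 < p) {h : ℕ → α → ℝ≥0∞}
    (hm : ∀ n, Measurable (h n)) (hfin : ∀ n, ∫⁻ x, h n x ^ p ∂μ ≠ ∞) :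
    ∃ σ : α → ℝ≥0∞, Measurable σ ∧ ∫⁻ x, σ x ^ p ∂μ < ∞ ∧
      ∀ n, ∃ c : ℝ≥0∞, c ≠ ∞ ∧ ∀ x, h n x ≤ c * σ x := by
  obtain ⟨δ, hδ, hsum⟩ := ENNReal.exists_pos_tsum_mul_lt_of_countable one_ne_zero _ hfin
  refine ⟨fun x => (∑' n, δ n * h n x ^ p) ^ p⁻¹, ?_, ?_, fun n => ⟨(δ n : ℝ≥0∞)⁻¹ ^ p⁻¹, ?_, ?_⟩⟩
  · exact (Measurable.tsum fun n => ((hm n).pow_const p).const_mul _).pow_const _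
  · simp only [ENNReal.rpow_inv_rpow hp.ne']
    rw [lintegral_tsum fun n => (((hm n).pow_const p).const_mul _).aemeasurable]
    simp only [lintegral_const_mul _ ((hm _).pow_const p)]
    refine lt_trans (lt_of_le_of_lt (le_of_eq ?_) hsum) ENNReal.one_lt_top
    exact tsum_congr fun n => mul_comm _ _
  · refine ENNReal.rpow_ne_top_of_nonneg (inv_nonneg.2 hp.le) (ENNReal.inv_ne_top.2 ?_)
    exact_mod_cast (hδ n).ne'
  · intro x
    rw [← ENNReal.mul_rpow_of_nonneg _ _ (inv_nonneg.2 hp.le), ENNReal.le_rpow_inv_iff hp]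
    have hδ0 : (δ n : ℝ≥0∞) ≠ 0 := by exact_mod_cast (hδ n).ne'
    calc h n x ^ p = (δ n : ℝ≥0∞)⁻¹ * (δ n * h n x ^ p) := by
          rw [← mul_assoc, ENNReal.inv_mul_cancel hδ0 ENNReal.coe_ne_top, one_mul]
      _ ≤ _ := by gcongr; exact ENNReal.le_tsum (f := fun n => δ n * h n x ^ p) n

end EssentialInfimum

/-! ### Existence and minimality of the minimal weak upper gradient -/

section Minimal

theorem UpperGradientOn.mono {X : Type*} [MetricSpace X] {u : X → EReal} {g h : X → ℝ≥0∞} {γ : Curve X}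
    (hg : UpperGradientOn u g γ) (hgh : ∀ x, g x ≤ h x) : UpperGradientOn u h γ :=
  le_trans hg (γ.lineIntegral_mono hgh)

variable {X : Type*} [MetricSpace X] [MeasurableSpace X] [BorelSpace X]

theorem Curve.Rectifiable.lineIntegral_const_mul {γ : Curve X} (hγ : γ.Rectifiable)
    {g : X → ℝ≥0∞} (hg : Measurable g) (c : ℝ≥0∞) :
    γ.lineIntegral (fun x => c * g x) = c * γ.lineIntegral g :=
  lintegral_const_mul'' c (hγ.aemeasurable_comp_arc hg)

/-- The upper gradient inequality for `g` holds on all curves along which `σ` is integrable. -/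
def UpperGradientOutside (u : X → EReal) (g σ : X → ℝ≥0∞) : Prop :=
  Measurable g ∧ Measurable σ ∧ ∀ γ : Curve X, γ.Rectifiable → γ.length ≠ 0 →
    γ.lineIntegral σ ≠ ∞ → UpperGradientOn u g γ

/-- On curves where the inequality for `g` may fail, `ε σ` already has infinite line integral. -/
theorem UpperGradientOutside.isUpperGradient {u : X → EReal} {g σ : X → ℝ≥0∞}
    (h : UpperGradientOutside u g σ) {ε : ℝ≥0∞} (hε : ε ≠ 0) :
    IsUpperGradient u (fun x => g x + ε * σ x) := by
  refine ⟨h.1.add (h.2.1.const_mul ε), fun γ hγ hγ0 => ?_⟩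
  by_cases hσ : γ.lineIntegral σ = ∞
  · have : γ.lineIntegral (fun x => g x + ε * σ x) = ∞ := by
      refine top_le_iff.1 (le_trans (le_of_eq ?_) (γ.lineIntegral_mono fun x => le_add_self))
      rw [hγ.lineIntegral_const_mul h.2.1, hσ, ENNReal.mul_top hε]
    rw [UpperGradientOn, this]
    exact le_top
  · exact (h.2.2 γ hγ hγ0 hσ).mono fun x => le_self_add

variable {N p : ℝ}

/-- All multiples `σ / n` are admissible for the exceptional curves, and their `p`-energies tend to
`0`. -/
theorem UpperGradientOutside.isWeakUpperGradient {u : X → EReal} {g σ : X → ℝ≥0∞}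
    (h : UpperGradientOutside u g σ) (hp : 0 < p) (hσ : ∫⁻ x, σ x ^ p ∂(hausdorff N) < ∞) :
    IsWeakUpperGradient N p u g := by
  refine ⟨h.1, nonpos_iff_eq_zero.1 ?_⟩
  have key : ∀ n : ℕ, modulus N p {γ : Curve X | γ.Rectifiable ∧ γ.length ≠ 0 ∧
      ¬ UpperGradientOn u g γ} ≤ ((n : ℝ≥0∞)⁻¹) ^ p * ∫⁻ x, σ x ^ p ∂(hausdorff N) := by
    intro n
    have hadm : Admissible {γ : Curve X | γ.Rectifiable ∧ γ.length ≠ 0 ∧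
        ¬ UpperGradientOn u g γ} (fun x => (n : ℝ≥0∞)⁻¹ * σ x) := by
      refine ⟨h.2.1.const_mul _, fun γ hγ hr => ?_⟩
      have : γ.lineIntegral σ = ∞ := by
        by_contra hne
        exact hγ.2.2 (h.2.2 γ hr hγ.2.1 hne)
      rw [hr.lineIntegral_const_mul h.2.1, this,
        ENNReal.mul_top (ENNReal.inv_ne_zero.2 (ENNReal.natCast_ne_top n))]
      exact le_top
    refine (iInf₂_le _ hadm).trans (le_of_eq ?_)
    simp only [ENNReal.mul_rpow_of_nonneg _ _ hp.le]
    rw [lintegral_const_mul _ (h.2.1.pow_const p)]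
  have hlim : Tendsto (fun n : ℕ => ((n : ℝ≥0∞)⁻¹) ^ p * ∫⁻ x, σ x ^ p ∂(hausdorff N (X := X)))
      atTop (𝓝 0) := by
    have h1 : Tendsto (fun n : ℕ => ((n : ℝ≥0∞)⁻¹) ^ p) atTop (𝓝 0) := by
      have := (ENNReal.continuous_rpow_const (y := p)).continuousAt.tendsto.comp
        ENNReal.tendsto_inv_nat_nhds_zero
      simpa [Function.comp_def, ENNReal.zero_rpow_of_pos hp] using this
    have := ENNReal.Tendsto.mul_const h1 (Or.inr hσ.ne)
    simpa using this
  exact ge_of_tendsto' hlim key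

/-- Choose `ρ n` admissible for the exceptional family with `p`-energy below `2^{-n} n^{-p}`, and
let `σ` be the `ℓ^p` sum of the `n ρ n`. An exceptional curve has `σ`-length at least `n` for every
`n`. -/
theorem IsWeakUpperGradient.exists_upperGradientOutside {u : X → EReal} {g : X → ℝ≥0∞}
    (h : IsWeakUpperGradient N p u g) (hp : 0 < p) :
    ∃ σ, ∫⁻ x, σ x ^ p ∂(hausdorff N) < ∞ ∧ UpperGradientOutside u g σ := by
  have hex : ∀ n : ℕ, ∃ ρ : X → ℝ≥0∞, Admissible {γ : Curve X | γ.Rectifiable ∧ γ.length ≠ 0 ∧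
      ¬ UpperGradientOn u g γ} ρ ∧
      ∫⁻ x, ρ x ^ p ∂(hausdorff N) < ((2 : ℝ≥0∞)⁻¹ ^ n) * ((n : ℝ≥0∞) ^ p)⁻¹ := by
    intro n
    have hpos : 0 < ((2 : ℝ≥0∞)⁻¹ ^ n) * ((n : ℝ≥0∞) ^ p)⁻¹ := by
      refine ENNReal.mul_pos (pow_ne_zero _ (by simp)) (ENNReal.inv_ne_zero.2 ?_)
      exact ENNReal.rpow_ne_top_of_nonneg hp.le (ENNReal.natCast_ne_top n)
    rw [← h.2, modulus] at hpos
    simpa only [iInf_lt_iff, exists_prop] using hpos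
  choose ρ hρ hρi using hex
  refine ⟨fun x => (∑' n : ℕ, (n : ℝ≥0∞) ^ p * ρ n x ^ p) ^ p⁻¹, ?_, h.1, ?_, ?_⟩
  · simp only [ENNReal.rpow_inv_rpow hp.ne']
    rw [lintegral_tsum fun n => (((hρ n).1.pow_const p).const_mul _).aemeasurable]
    simp only [lintegral_const_mul _ ((hρ _).1.pow_const p)]
    have hle : ∀ n : ℕ, (n : ℝ≥0∞) ^ p * ∫⁻ x, ρ n x ^ p ∂(hausdorff N) ≤ (2 : ℝ≥0∞)⁻¹ ^ n := by
      intro n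
      refine (mul_le_mul_right (hρi n).le _).trans ?_
      rw [mul_comm, mul_assoc]
      exact mul_le_of_le_one_right' (ENNReal.inv_mul_le_one _)
    refine lt_of_le_of_lt (ENNReal.tsum_le_tsum hle) ?_
    rw [ENNReal.tsum_geometric]
    simp
  · exact (Measurable.tsum fun n => ((hρ n).1.pow_const p).const_mul _).pow_const _
  · intro γ hγ hγ0 hfin
    by_contra hne
    refine hfin (ENNReal.eq_top_of_forall_nnreal_le fun r => ?_)
    obtain ⟨n, hn⟩ := exists_nat_ge r
    calc (r : ℝ≥0∞) ≤ n * 1 := by rw [mul_one]; exact_mod_cast hn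
      _ ≤ n * γ.lineIntegral (ρ n) := by
          gcongr
          exact (hρ n).2 γ ⟨hγ, hγ0, hne⟩ hγ
      _ = γ.lineIntegral (fun x => n * ρ n x) := (hγ.lineIntegral_const_mul (hρ n).1 _).symm
      _ ≤ _ := γ.lineIntegral_mono fun x => by
          rw [ENNReal.le_rpow_inv_iff hp, ENNReal.mul_rpow_of_nonneg _ _ hp.le]
          exact ENNReal.le_tsum (f := fun n : ℕ => (n : ℝ≥0∞) ^ p * ρ n x ^ p) n

/-- Existence of the minimal weak upper gradient, with an explicit exceptional function. -/
theorem exists_isMinimalWeakUpperGradient (hp : 0 < p) {u : X → EReal}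
    (hu : MemNewtonian N p u) :
    ∃ g σ : X → ℝ≥0∞, IsMinimalWeakUpperGradient N p u g ∧ UpperGradientOutside u g σ ∧
      ∫⁻ x, σ x ^ p ∂(hausdorff N) < ∞ := by
  obtain ⟨-, -, h₀, hh₀, hh₀'⟩ := hu
  obtain ⟨h, hhG, hmin⟩ := exists_seq_iInf_ae_le (μ := hausdorff N) hp
    (G := {h : X → ℝ≥0∞ | IsUpperGradient u h ∧ ∫⁻ x, h x ^ p ∂(hausdorff N) < ∞})
    ⟨h₀, hh₀, hh₀'⟩ (fun h hh => ⟨hh.1.1, hh.2⟩)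
  obtain ⟨σ, hσm, hσ, hc⟩ := exists_lintegral_rpow_lt_top_of_seq (μ := hausdorff N) hp
    (fun n => (hhG n).1.1) (fun n => (hhG n).2.ne)
  have hout : UpperGradientOutside u (fun x => ⨅ n, h n x) σ := by
    refine ⟨Measurable.iInf fun n => (hhG n).1.1, hσm, fun γ hγ hγ0 hfin => ?_⟩
    refine upperGradientOn_iInf (fun n => (hhG n).1) hγ hγ0 fun n => ?_
    obtain ⟨c, hc, hle⟩ := hc n
    refine ne_top_of_le_ne_top ?_ (γ.lineIntegral_mono hle)
    rw [hγ.lineIntegral_const_mul hσm]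
    exact ENNReal.mul_ne_top hc hfin
  refine ⟨_, σ, ⟨hout.isWeakUpperGradient hp hσ, ?_, fun k hk hk' => hmin k ⟨hk, hk'⟩⟩, hout, hσ⟩
  refine lt_of_le_of_lt (lintegral_mono fun x => ?_) (hhG 0).2
  exact ENNReal.rpow_le_rpow (iInf_le _ 0) hp.le

/-- Minimality is only tested against upper gradients. Adding `σ / n` to `g'` produces such
functions, and `n → ∞` removes the extra term where `σ` is finite. -/
theorem IsMinimalWeakUpperGradient.ae_le {u : X → EReal} {g g' : X → ℝ≥0∞} (hp : 1 ≤ p)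
    (hg : IsMinimalWeakUpperGradient N p u g) (hg' : IsWeakUpperGradient N p u g')
    (hfin' : ∫⁻ x, g' x ^ p ∂(hausdorff N) < ∞) :
    g ≤ᵐ[hausdorff N] g' := by
  have hp0 : 0 < p := zero_lt_one.trans_le hp
  obtain ⟨σ, hσ, hout⟩ := hg'.exists_upperGradientOutside hp0
  have hle : ∀ n : ℕ, ∀ᵐ x ∂(hausdorff N), g x ≤ g' x + (n : ℝ≥0∞)⁻¹ * σ x := by
    intro n
    rcases eq_or_ne n 0 with rfl | hn
    -- The coefficient `0⁻¹ = ∞` would destroy integrability; the bound with coefficient `1` is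
    -- stronger.
    · have := hg.2.2 _ (hout.isUpperGradient one_ne_zero)
        (ENNReal.lintegral_rpow_add_lt_top_of_lintegral_rpow_lt_top hg'.1.aemeasurable
          hfin' (by simpa using hσ) hp)
      filter_upwards [this] with x hx
      refine hx.trans (by gcongr; simp)
    refine hg.2.2 _ (hout.isUpperGradient (ENNReal.inv_ne_zero.2 (ENNReal.natCast_ne_top n))) ?_
    refine ENNReal.lintegral_rpow_add_lt_top_of_lintegral_rpow_lt_top hg'.1.aemeasurable
      hfin' ?_ hp
    simp only [ENNReal.mul_rpow_of_nonneg _ _ hp0.le]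
    rw [lintegral_const_mul _ (hout.2.1.pow_const p)]
    refine ENNReal.mul_lt_top (ENNReal.rpow_lt_top_of_nonneg hp0.le ?_) hσ
    simpa using hn
  have hσfin : ∀ᵐ x ∂(hausdorff N), σ x ^ p < ∞ :=
    ae_lt_top (hout.2.1.pow_const p) hσ.ne
  filter_upwards [ae_all_iff.2 hle, hσfin] with x hx hσx
  have hσx' : σ x ≠ ∞ := fun h => by simp [h, ENNReal.top_rpow_of_pos hp0] at hσx
  have hlim : Tendsto (fun n : ℕ => g' x + (n : ℝ≥0∞)⁻¹ * σ x) atTop (𝓝 (g' x + 0 * σ x)) :=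
    tendsto_const_nhds.add
      (ENNReal.Tendsto.mul_const ENNReal.tendsto_inv_nat_nhds_zero (Or.inr hσx'))
  rw [zero_mul, add_zero] at hlim
  exact ge_of_tendsto' hlim hx

end Minimal

/-! ### Approximation from above by lower semicontinuous functions -/

section VitaliCaratheodory

variable {α : Type*} [TopologicalSpace α] [MeasurableSpace α] [BorelSpace α] {μ : Measure α}
  [μ.WeaklyRegular] {p : ℝ}

/-- The Vitali-Carathéodory theorem in `L^p`. -/
theorem exists_lowerSemicontinuous_rpow (hp : 1 ≤ p) {f : α → ℝ≥0∞} (hf : Measurable f)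
    (hfin : ∫⁻ x, f x ^ p ∂μ ≠ ∞) {ε : ℝ≥0∞} (hε : ε ≠ 0) [SigmaFinite μ] :
    ∃ g e : α → ℝ≥0∞, LowerSemicontinuous g ∧ (∀ x, f x ≤ g x) ∧ Measurable e ∧
      (∀ x, g x = f x + e x) ∧ ∫⁻ x, e x ^ p ∂μ ≤ ε := by
  have hp0 : 0 < p := zero_lt_one.trans_le hp
  obtain ⟨G, hfG, hG, hGi⟩ :=
    exists_le_lowerSemicontinuous_lintegral_ge μ _ (hf.pow_const p) hε
  have hle : ∀ x, f x ≤ G x ^ p⁻¹ := fun x => (ENNReal.le_rpow_inv_iff hp0).2 (hfG x)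
  refine ⟨fun x => G x ^ p⁻¹, fun x => G x ^ p⁻¹ - f x, ?_, hle,
    (hG.measurable.pow_const _).sub hf, fun x => (add_tsub_cancel_of_le (hle x)).symm, ?_⟩
  · exact (ENNReal.continuous_rpow_const (y := p⁻¹)).comp_lowerSemicontinuous hG
      (ENNReal.monotone_rpow_of_nonneg (inv_nonneg.2 hp0.le))
  -- As `a^p + b^p ≤ (a + b)^p` for `p ≥ 1`, the `L^1` error for `f^p` bounds the `p`-th power of
  -- the `L^p` error for its root.
  · have h1 : ∀ x, (G x ^ p⁻¹ - f x) ^ p + f x ^ p ≤ G x := by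
      intro x
      refine (ENNReal.add_rpow_le_rpow_add _ _ hp).trans ?_
      rw [tsub_add_cancel_of_le (hle x), ENNReal.rpow_inv_rpow hp0.ne']
    have h2 : ∫⁻ x, (G x ^ p⁻¹ - f x) ^ p ∂μ + ∫⁻ x, f x ^ p ∂μ ≤ ε + ∫⁻ x, f x ^ p ∂μ := by
      rw [← lintegral_add_right _ (hf.pow_const p), add_comm ε]
      exact (lintegral_mono h1).trans hGi
    exact (ENNReal.add_le_add_iff_right hfin).1 h2

end VitaliCaratheodory

/-! ### Approximation from below by Lipschitz functions -/

section LipschitzApproximation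

variable {X : Type*} [PseudoEMetricSpace X]

/-- The `n`-Lipschitz regularization of `min g n` from below. -/
def lipschitzMinorant (g : X → ℝ≥0∞) (n : ℕ) (x : X) : ℝ≥0∞ :=
  ⨅ y, min (g y) n + n * edist x y

variable (g : X → ℝ≥0∞) (n : ℕ)

theorem lipschitzMinorant_le_min (x : X) : lipschitzMinorant g n x ≤ min (g x) n :=
  (iInf_le _ x).trans (by simp)

theorem lipschitzMinorant_le (x : X) : lipschitzMinorant g n x ≤ g x :=
  (lipschitzMinorant_le_min g n x).trans (min_le_left _ _)

theorem lipschitzMinorant_le_natCast (x : X) : lipschitzMinorant g n x ≤ n :=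
  (lipschitzMinorant_le_min g n x).trans (min_le_right _ _)

theorem lipschitzMinorant_le_add (x y : X) :
    lipschitzMinorant g n x ≤ lipschitzMinorant g n y + n * edist x y := by
  rw [lipschitzMinorant, lipschitzMinorant, ENNReal.iInf_add]
  refine le_iInf fun z => (iInf_le _ z).trans ?_
  rw [add_assoc, ← mul_add, add_comm (edist y z)]
  gcongr
  exact edist_triangle _ _ _

theorem continuous_lipschitzMinorant : Continuous (lipschitzMinorant g n) :=
  continuous_of_le_add_edist n (ENNReal.natCast_ne_top n) (lipschitzMinorant_le_add g n)

theorem lipschitzMinorant_mono : Monotone (lipschitzMinorant g) := by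
  intro m n hmn x
  refine iInf_mono fun y => ?_
  have : (m : ℝ≥0∞) ≤ n := by exact_mod_cast hmn
  gcongr

theorem le_lipschitzMinorant {c : ℝ≥0∞} (hc : ∀ x, c ≤ g x) (hn : c ≤ n) (x : X) :
    c ≤ lipschitzMinorant g n x :=
  le_iInf fun y => (le_min (hc y) hn).trans le_self_add

variable {g}

/-- If `c < g x`, then `g > c` on a ball around `x`. For large `n`, points of the ball contribute at
least `c` by their value, and points outside by the penalty `n * edist x y`. -/
theorem iSup_lipschitzMinorant (hg : LowerSemicontinuous g) (x : X) :
    ⨆ n, lipschitzMinorant g n x = g x := by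
  refine le_antisymm (iSup_le fun n => lipschitzMinorant_le g n x) ?_
  refine le_of_forall_lt_imp_le_of_dense fun c hc => ?_
  obtain ⟨r, hr, hball⟩ := EMetric.mem_nhds_iff.1 (hg x c hc)
  have hcfin : c ≠ ∞ := ne_top_of_lt hc
  obtain ⟨n₁, hn₁⟩ := ENNReal.exists_nat_gt hcfin
  obtain ⟨n₂, hn₂⟩ := ENNReal.exists_nat_mul_gt hr.ne' hcfin
  refine le_trans ?_ (le_iSup _ (max n₁ n₂))
  refine le_iInf fun y => ?_
  by_cases hy : y ∈ Metric.eball x r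
  · refine (le_min (hball hy).le (hn₁.le.trans ?_)).trans le_self_add
    exact_mod_cast le_max_left _ _
  · rw [Metric.mem_eball, not_lt, edist_comm] at hy
    refine (hn₂.le.trans ?_).trans le_add_self
    gcongr
    exact_mod_cast le_max_right _ _

end LipschitzApproximation

/-! ### Coarse curves and the distance they define -/

section CoarseCurves

variable {X : Type*} [MetricSpace X]

/-- A map on `[0, ℓ]`, not necessarily continuous, that starts in `E`, ends in `x` and has unit
speed up to an error `r`. -/
def IsCoarseCurve (E : Set X) (r : ℝ) (x : X) (ℓ : ℝ) (σ : ℝ → X) : Prop :=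
  0 ≤ ℓ ∧ σ 0 ∈ E ∧ σ ℓ = x ∧
    ∀ s ∈ Icc 0 ℓ, ∀ t ∈ Icc 0 ℓ, dist (σ s) (σ t) ≤ |s - t| + r

/-- The smallest integral of `φ` along coarse curves from `E` to `x`. -/
def coarseDist (E : Set X) (r : ℝ) (φ : X → ℝ≥0∞) (x : X) : ℝ≥0∞ :=
  ⨅ (ℓ : ℝ) (σ : ℝ → X) (_ : IsCoarseCurve E r x ℓ σ), ∫⁻ t in Icc 0 ℓ, φ (σ t)

theorem coarseDist_of_mem {E : Set X} {r : ℝ} (hr : 0 ≤ r) (φ : X → ℝ≥0∞) {x : X} (hx : x ∈ E) :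
    coarseDist E r φ x = 0 := by
  refine le_antisymm ?_ (by simp)
  refine (iInf₂_le 0 fun _ => x).trans ((iInf_le _ ⟨le_rfl, hx, rfl, ?_⟩).trans (by simp))
  intro s _ t _
  rw [dist_self]
  positivity

/-- Extend a coarse curve ending in `x` by waiting at `x` for time `dist x y` and jumping to `y` at
the last instant. The wait costs `φ x * edist x y`, the jump costs nothing and is absorbed by the
tolerance `r`. -/
theorem coarseDist_le_add {E : Set X} {r : ℝ} (φ : X → ℝ≥0∞) {x y : X}
    (hxy : dist x y ≤ r) :
    coarseDist E r φ y ≤ coarseDist E r φ x + φ x * edist x y := by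
  simp only [coarseDist, ENNReal.iInf_add]
  refine le_iInf fun ℓ => le_iInf fun σ => le_iInf fun hσ => ?_
  obtain ⟨hℓ, h0, hx, hd⟩ := hσ
  rcases eq_or_ne x y with rfl | hne
  · exact (iInf₂_le ℓ σ).trans ((iInf_le _ ⟨hℓ, h0, hx, hd⟩).trans le_self_add)
  have hdpos : 0 < dist x y := dist_pos.2 hne
  let τ : ℝ → X := fun t => if t ≤ ℓ then σ t else if t < ℓ + dist x y then x else y
  have hr : 0 ≤ r := dist_nonneg.trans hxy
  have τ1 : ∀ t, t ≤ ℓ → τ t = σ t := fun t ht => if_pos ht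
  have τ2 : ∀ t, ℓ ≤ t → t < ℓ + dist x y → τ t = x := fun t ht ht' => by
    rcases ht.eq_or_lt with rfl | h
    · rw [τ1 _ le_rfl, hx]
    · simp only [τ, if_neg h.not_ge, if_pos ht']
  have τ3 : τ (ℓ + dist x y) = y := by
    simp [τ, hdpos.not_ge]
  have key : ∀ s ∈ Icc 0 (ℓ + dist x y), ∀ t ∈ Icc 0 (ℓ + dist x y), s ≤ t →
      dist (τ s) (τ t) ≤ t - s + r := by
    intro s hs t ht hst
    have hsx : ∀ s, 0 ≤ s → s ≤ ℓ → dist (σ s) x ≤ ℓ - s + r := fun s hs hsl => by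
      have := hd s ⟨hs, hsl⟩ ℓ ⟨hℓ, le_rfl⟩
      rwa [hx, abs_sub_comm, abs_of_nonneg (sub_nonneg.2 hsl)] at this
    rcases le_or_gt t ℓ with h1 | h1
    · rw [τ1 t h1, τ1 s (hst.trans h1)]
      have := hd s ⟨hs.1, hst.trans h1⟩ t ⟨ht.1, h1⟩
      rwa [abs_sub_comm, abs_of_nonneg (sub_nonneg.2 hst)] at this
    rcases ht.2.lt_or_eq with h2 | h2
    · rw [τ2 t h1.le h2]
      rcases le_or_gt s ℓ with h3 | h3
      · rw [τ1 s h3]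
        linarith [hsx s hs.1 h3]
      · rw [τ2 s h3.le (hst.trans_lt h2), dist_self]
        linarith
    · rw [h2, τ3]
      rcases le_or_gt s ℓ with h3 | h3
      · rw [τ1 s h3]
        linarith [hsx s hs.1 h3, dist_triangle (σ s) x y]
      · rcases hs.2.lt_or_eq with h4 | h4
        · rw [τ2 s h3.le h4]
          linarith
        · rw [h4, τ3, dist_self]
          linarith
  have hτ : IsCoarseCurve E r y (ℓ + dist x y) τ := by
    refine ⟨by positivity, by rwa [τ1 0 hℓ], τ3, fun s hs t ht => ?_⟩
    rcases le_total s t with h | h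
    · rw [abs_sub_comm, abs_of_nonneg (sub_nonneg.2 h)]
      exact key s hs t ht h
    · rw [abs_of_nonneg (sub_nonneg.2 h), dist_comm]
      exact key t ht s hs h
  refine (iInf₂_le (ℓ + dist x y) τ).trans ((iInf_le _ hτ).trans ?_)
  have hsub : Icc 0 (ℓ + dist x y) ⊆ (Icc 0 ℓ ∪ Ico ℓ (ℓ + dist x y)) ∪ {ℓ + dist x y} := by
    intro t ht
    rcases le_or_gt t ℓ with h1 | h1
    · exact Or.inl (Or.inl ⟨ht.1, h1⟩)
    rcases ht.2.lt_or_eq with h2 | h2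
    · exact Or.inl (Or.inr ⟨h1.le, h2⟩)
    · exact Or.inr h2
  refine (lintegral_mono_set hsub).trans ((lintegral_union_le _ _ _).trans ?_)
  have hz : ∫⁻ t in ({ℓ + dist x y} : Set ℝ), φ (τ t) = 0 :=
    setLIntegral_measure_zero _ _ (by simp)
  rw [hz, add_zero]
  refine (lintegral_union_le _ _ _).trans (add_le_add (le_of_eq ?_) (le_of_eq ?_))
  · exact setLIntegral_congr_fun measurableSet_Icc fun t ht => by rw [τ1 t ht.2]
  · rw [setLIntegral_congr_fun (g := fun _ => φ x) measurableSet_Ico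
      fun t ht => by rw [τ2 t ht.1 ht.2], setLIntegral_const, Real.volume_Ico, edist_dist]
    congr 2
    ring

end CoarseCurves

/-! ### Compactness of coarse curves -/

section Limit

variable {X : Type*} [MetricSpace X] [CompactSpace X]

/-- Coarse curves of bounded length from `E` to `F` have a limit that is a Lipschitz curve. The
convergence is with respect to an ultrafilter. -/
theorem exists_limit_of_isCoarseCurve {E F : Set X} (hE : IsClosed E) (hF : IsClosed F)
    (U : Ultrafilter ℕ) {r : ℕ → ℝ} (hr : Tendsto r U (𝓝 0)) {ℓ : ℕ → ℝ} {σ : ℕ → ℝ → X} {x : ℕ → X}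
    (hx : ∀ n, x n ∈ F) (hσ : ∀ n, IsCoarseCurve E (r n) (x n) (ℓ n) (σ n)) {Λ : ℝ}
    (hΛ : ∀ n, ℓ n ≤ Λ) :
    ∃ (l : ℝ) (c : ℝ → X), 0 ≤ l ∧ l ≤ Λ ∧ c 0 ∈ E ∧ c l ∈ F ∧ LipschitzOnWith 1 c (Icc 0 l) ∧
      Tendsto ℓ U (𝓝 l) ∧
      ∀ ε > 0, ∀ᶠ n in U, ∀ t ∈ Icc 0 l, t ≤ ℓ n → dist (c t) (σ n t) ≤ 4 * ε := by
  obtain ⟨l, hl, hlim⟩ : ∃ l ∈ Icc 0 Λ, Tendsto ℓ U (𝓝 l) := by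
    have := isCompact_Icc.ultrafilter_le_nhds (U.map ℓ) (by
      rw [Ultrafilter.coe_map, le_principal_iff]
      exact Eventually.of_forall (f := (U : Filter ℕ)) fun n => ⟨(hσ n).1, hΛ n⟩)
    exact this
  -- Each `σ n` is frozen after time `ℓ n`, so that all are compared at the same times. The
  -- ultrafilter gives limits at all `t` at once.
  have hlimex : ∀ t : ℝ, ∃ y, Tendsto (fun n => σ n (min t (ℓ n))) U (𝓝 y) := fun t =>
    let ⟨y, _, hy⟩ := isCompact_univ.ultrafilter_le_nhds (U.map fun n => σ n (min t (ℓ n)))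
      (by simp)
    ⟨y, hy⟩
  choose c hc using hlimex
  have hmem : ∀ n t, 0 ≤ t → min t (ℓ n) ∈ Icc 0 (ℓ n) := fun n t ht =>
    ⟨le_min ht (hσ n).1, min_le_right _ _⟩
  have hdn : ∀ n s t, 0 ≤ s → 0 ≤ t →
      dist (σ n (min s (ℓ n))) (σ n (min t (ℓ n))) ≤ |s - t| + r n := fun n s t hs ht =>
    ((hσ n).2.2.2 _ (hmem n s hs) _ (hmem n t ht)).trans
      (add_le_add (abs_inf_sub_inf_le_abs s t (ℓ n)) le_rfl)
  have hcd : ∀ s t, 0 ≤ s → 0 ≤ t → dist (c s) (c t) ≤ |s - t| := by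
    intro s t hs ht
    have h1 : Tendsto (fun n => |s - t| + r n) U (𝓝 (|s - t| + 0)) := tendsto_const_nhds.add hr
    rw [add_zero] at h1
    exact le_of_tendsto_of_tendsto' ((hc s).dist (hc t)) h1 fun n => hdn n s t hs ht
  refine ⟨l, c, hl.1, hl.2, ?_, ?_, ?_, hlim, ?_⟩
  · refine hE.mem_of_tendsto (hc 0) (Eventually.of_forall fun n => ?_)
    rw [min_eq_left (hσ n).1]
    exact (hσ n).2.1
  · obtain ⟨y, -, hy⟩ := isCompact_univ.ultrafilter_le_nhds (U.map x) (by simp)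
    have hy : Tendsto x U (𝓝 y) := hy
    have hyF : y ∈ F := hF.mem_of_tendsto hy (Eventually.of_forall hx)
    have h1 : Tendsto (fun n => |l - ℓ n| + r n) U (𝓝 (|l - l| + 0)) :=
      (tendsto_const_nhds.sub hlim).abs.add hr
    rw [sub_self, abs_zero, add_zero] at h1
    have h2 : dist (c l) y ≤ 0 := le_of_tendsto_of_tendsto' ((hc l).dist hy) h1 fun n => by
      have := hdn n l (ℓ n) hl.1 (hσ n).1
      rwa [min_self, (hσ n).2.2.1] at this
    rwa [dist_le_zero.1 h2]
  · refine LipschitzOnWith.of_dist_le_mul fun s hs t ht => ?_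
    simpa [Real.dist_eq] using hcd s t hs.1 ht.1
  · intro ε hε
    obtain ⟨M, hM⟩ := exists_nat_gt (Λ / ε)
    -- Convergence on a finite `ε`-grid suffices: moving to a grid point costs `ε` for `c` and less
    -- than `2 * ε` for `σ n`, and the error at the grid point is below `ε`.
    have hgrid : ∀ᶠ n in U, ∀ j ∈ Finset.range (M + 1),
        dist (c (j * ε)) (σ n (min (j * ε) (ℓ n))) < ε := by
      rw [eventually_all_finset]
      intro j _
      have := (tendsto_const_nhds (x := c (j * ε))).dist (hc (j * ε))
      rw [dist_self] at this
      exact this.eventually_lt_const hε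
    filter_upwards [hgrid, hr.eventually_lt_const hε] with n hn hrn t ht htn
    have h1 : (⌊t / ε⌋₊ : ℝ) ≤ t / ε := Nat.floor_le (div_nonneg ht.1 hε.le)
    have h2 : t / ε < ⌊t / ε⌋₊ + 1 := Nat.lt_floor_add_one _
    rw [le_div_iff₀ hε] at h1
    rw [div_lt_iff₀ hε] at h2
    have hj : ⌊t / ε⌋₊ ∈ Finset.range (M + 1) := by
      rw [Finset.mem_range, Nat.lt_succ_iff]
      refine Nat.floor_le_of_le (le_trans ?_ hM.le)
      gcongr
      exact ht.2.trans hl.2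
    have h3 := hn _ hj
    set j : ℝ := (⌊t / ε⌋₊ : ℝ)
    have hj0 : 0 ≤ j * ε := by positivity
    have h4 := hcd t (j * ε) ht.1 hj0
    have h5 := hdn n (j * ε) t hj0 ht.1
    rw [abs_of_nonneg (by linarith)] at h4
    rw [abs_sub_comm, abs_of_nonneg (by linarith), min_eq_left htn] at h5
    have h6 := dist_triangle4 (c t) (c (j * ε)) (σ n (min (j * ε) (ℓ n))) (σ n t)
    linarith

end Limit

/-! ### Lipschitz functions with prescribed boundary values -/

section LipschitzPotential

/-- A function with small increments on small scales that takes values in `[0, 1]` is Lipschitz. -/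
theorem exists_lipschitzWith_of_local {X : Type*} [PseudoMetricSpace X] {f : X → ℝ} (hf : ∀ x, f x ∈ Icc (0 : ℝ) 1) {r C : ℝ}
    (hr : 0 < r) (hC : 0 ≤ C) (h : ∀ x y, dist x y ≤ r → f y - f x ≤ C * dist x y) :
    ∃ K, LipschitzWith K f := by
  -- The term `C` serves distances up to `r`; beyond `r`, the oscillation bound `1` gives `1 / r`.
  refine ⟨Real.toNNReal (C + 1 / r), LipschitzWith.of_le_add_mul _ fun y x => ?_⟩
  rw [Real.coe_toNNReal _ (by positivity), dist_comm]
  rcases le_or_gt (dist x y) r with hxy | hxy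
  · have h1 := h x y hxy
    have h2 : 0 ≤ 1 / r * dist x y := by positivity
    linarith [add_mul C (1 / r) (dist x y)]
  · have h1 : 1 ≤ 1 / r * dist x y := by
      rw [one_div, ← div_eq_inv_mul, le_div_iff₀ hr]
      linarith
    have h2 : 0 ≤ C * dist x y := by positivity
    linarith [add_mul C (1 / r) (dist x y), (hf y).2, (hf x).1]

variable {X : Type*} [MetricSpace X] [CompactSpace X]

/-- If every curve from `E` to `F` has `g`-length at least `1`, then on a sufficiently fine scale
coarse curves from `E` to `F` have almost at least this length. -/
theorem exists_le_coarseDist {E F : Set X} (hE : IsClosed E) (hF : IsClosed F)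
    (hEF : Disjoint E F) {g : X → ℝ≥0∞} (hg : LowerSemicontinuous g) {η : ℝ≥0∞} (hη : η ≠ 0)
    (hηg : ∀ x, η ≤ g x)
    (hcurve : ∀ γ : Curve X, γ.Rectifiable → γ.length ≠ 0 → γ.toFun γ.left ∈ E →
      γ.toFun γ.right ∈ F → 1 ≤ γ.lineIntegral g)
    {a : ℝ≥0∞} (ha : a < 1) :
    ∃ n : ℕ, ∀ x ∈ F, a ≤ coarseDist E (1 / ((n : ℝ) + 1)) (lipschitzMinorant g (n + 1)) x := by
  by_contra! hcon
  choose x hxF hx using hcon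
  simp only [coarseDist, iInf_lt_iff, exists_prop] at hx
  choose ℓ σ hσ hcost using hx
  -- The minorant is truncated at `n + 1`, and inherits the lower bound `η` for all `n` if `η ≤ 1`.
  -- This bound limits the lengths `ℓ n`.
  wlog hη1 : η ≤ 1 generalizing η
  · exact this (η := min η 1) (by simp [hη]) (fun y => (min_le_left _ _).trans (hηg y))
      (min_le_right _ _)
  have hΛ : ∀ n, ℓ n ≤ (η⁻¹).toReal := by
    intro n
    have h1 : η * ENNReal.ofReal (ℓ n) ≤ 1 := by
      calc η * ENNReal.ofReal (ℓ n) = ∫⁻ t in Icc 0 (ℓ n), η := by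
            rw [setLIntegral_const, Real.volume_Icc, sub_zero]
        _ ≤ ∫⁻ t in Icc 0 (ℓ n), lipschitzMinorant g (n + 1) (σ n t) :=
            lintegral_mono fun t => le_lipschitzMinorant g _ hηg
              (hη1.trans (by exact_mod_cast Nat.le_add_left 1 n)) _
        _ ≤ 1 := ((hcost n).trans ha).le
    have h2 : ENNReal.ofReal (ℓ n) ≤ η⁻¹ := by
      rw [ENNReal.le_inv_iff_mul_le, mul_comm]
      exact h1
    have := ENNReal.toReal_mono (ENNReal.inv_ne_top.2 hη) h2
    rwa [ENNReal.toReal_ofReal (hσ n).1] at this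
  have hU : (hyperfilter ℕ : Filter ℕ) ≤ atTop := Nat.hyperfilter_le_atTop
  obtain ⟨l, c, hl, hlΛ, hc0, hcl, hlip, hlim, hunif⟩ := exists_limit_of_isCoarseCurve hE hF
    (hyperfilter ℕ) (tendsto_one_div_add_atTop_nhds_zero_nat.mono_left hU) hxF hσ hΛ
  have hbound : ∀ m : ℕ, ∫⁻ t in Icc 0 l, lipschitzMinorant g m (c t) ≤ a := by
    intro m
    -- For `n ≥ m`, the minorant of index `m` lies below the one of index `n + 1` and is
    -- `m`-Lipschitz, so passing from `c` to `σ n` costs at most `4 * m * ε` per unit length. Since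
    -- `ℓ n` may be less than `l`, the piece `[l - ε, l]` is estimated by the bound `m` instead.
    have key : ∀ ε : ℝ, 0 < ε → ∫⁻ t in Icc 0 l, lipschitzMinorant g m (c t) ≤
        a + ENNReal.ofReal ((4 * l + 1) * m * ε) := by
      intro ε hε
      have hev := (((hunif ε hε).and (hlim.eventually_const_lt (show l - ε < l by linarith))).and
        (hU (eventually_ge_atTop m))).exists
      obtain ⟨n, ⟨hn1, hn2⟩, hn3⟩ := hev
      have hsub : Icc 0 l ⊆ Icc 0 (l - ε) ∪ Icc (l - ε) l := fun t ht => by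
        rcases le_total t (l - ε) with h | h
        · exact Or.inl ⟨ht.1, h⟩
        · exact Or.inr ⟨h, ht.2⟩
      have h1 : ∫⁻ t in Icc (l - ε) l, lipschitzMinorant g m (c t) ≤ m * ENNReal.ofReal ε := by
        calc _ ≤ ∫⁻ t in Icc (l - ε) l, (m : ℝ≥0∞) :=
              lintegral_mono fun t => lipschitzMinorant_le_natCast g m _
          _ = _ := by rw [setLIntegral_const, Real.volume_Icc, sub_sub_cancel]
      have h2 : ∫⁻ t in Icc 0 (l - ε), lipschitzMinorant g m (c t) ≤
          a + m * ENNReal.ofReal (4 * ε) * ENNReal.ofReal l := by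
        calc _ ≤ ∫⁻ t in Icc 0 (l - ε),
              (lipschitzMinorant g (n + 1) (σ n t) + m * ENNReal.ofReal (4 * ε)) := by
              refine setLIntegral_mono' measurableSet_Icc fun t ht => ?_
              refine (lipschitzMinorant_le_add g m (c t) (σ n t)).trans ?_
              refine add_le_add (lipschitzMinorant_mono g (by omega) _) ?_
              gcongr
              rw [edist_dist]
              exact ENNReal.ofReal_le_ofReal
                (hn1 t ⟨ht.1, by linarith [ht.2]⟩ (by linarith [ht.2]))
          _ = (∫⁻ t in Icc 0 (l - ε), lipschitzMinorant g (n + 1) (σ n t)) +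
              m * ENNReal.ofReal (4 * ε) * ENNReal.ofReal (l - ε) := by
              rw [lintegral_add_right _ measurable_const, setLIntegral_const, Real.volume_Icc,
                sub_zero]
          _ ≤ a + m * ENNReal.ofReal (4 * ε) * ENNReal.ofReal l := by
              refine add_le_add ?_ (by gcongr; linarith)
              exact (lintegral_mono_set (Icc_subset_Icc le_rfl hn2.le)).trans (hcost n).le
      refine (lintegral_mono_set hsub).trans ((lintegral_union_le _ _ _).trans
        ((add_le_add h2 h1).trans (le_of_eq ?_)))
      rw [add_assoc]
      congr 1
      rw [← ENNReal.ofReal_natCast, ← ENNReal.ofReal_mul (by positivity),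
        ← ENNReal.ofReal_mul (by positivity), ← ENNReal.ofReal_mul (by positivity),
        ← ENNReal.ofReal_add (by positivity) (by positivity)]
      congr 1
      ring
    have hcont : Tendsto (fun ε : ℝ => a + ENNReal.ofReal ((4 * l + 1) * m * ε)) (𝓝[>] 0)
        (𝓝 (a + ENNReal.ofReal ((4 * l + 1) * m * 0))) := by
      refine tendsto_const_nhds.add (ENNReal.tendsto_ofReal ?_)
      exact (tendsto_const_nhds.mul tendsto_id).mono_left nhdsWithin_le_nhds
    rw [mul_zero, ENNReal.ofReal_zero, add_zero] at hcont
    exact ge_of_tendsto hcont (by filter_upwards [self_mem_nhdsWithin] with ε hε using key ε hε)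
  let γ : Curve X := ⟨0, l, hl, c, hlip.continuousOn⟩
  obtain ⟨hγ, hline⟩ := lineIntegral_le_of_lipschitzOnWith (γ := γ) hlip
  have hγ0 : γ.length ≠ 0 := by
    have h1 : edist (c 0) (c l) ≤ γ.length := eVariationOn.edist_le c γ.left_mem γ.right_mem
    intro h0
    rw [h0, nonpos_iff_eq_zero, edist_eq_zero] at h1
    exact hEF.le_bot ⟨hc0, h1 ▸ hcl⟩
  have hone := (hcurve γ hγ hγ0 hc0 hcl).trans (hline g)
  have hmono : ∫⁻ t in Icc 0 l, g (c t) ≤ a := by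
    have hm : ∀ m, AEMeasurable (fun t => lipschitzMinorant g m (c t))
        (volume.restrict (Icc 0 l)) := fun m =>
      ((continuous_lipschitzMinorant g m).comp_continuousOn hlip.continuousOn).aemeasurable
        measurableSet_Icc
    calc ∫⁻ t in Icc 0 l, g (c t) = ∫⁻ t in Icc 0 l, ⨆ m, lipschitzMinorant g m (c t) := by
          simp only [iSup_lipschitzMinorant hg]
      _ = ⨆ m, ∫⁻ t in Icc 0 l, lipschitzMinorant g m (c t) :=
          lintegral_iSup' hm (Eventually.of_forall fun t m n hmn =>
            lipschitzMinorant_mono g hmn _)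
      _ ≤ a := iSup_le hbound
  rw [ENNReal.coe_one, one_mul] at hone
  exact absurd (hone.trans hmono) (not_le.2 ha)

/-- If every curve from `E` to `F` has `g`-length at least `1`, then there is a Lipschitz function
with boundary values `0` on `E` and `1` on `F` whose local Lipschitz constants are almost bounded
by `g`. -/
theorem exists_lipschitz_potential {E F : Set X} (hE : IsClosed E) (hF : IsClosed F)
    (hEF : Disjoint E F) {g : X → ℝ≥0∞} (hg : LowerSemicontinuous g) {η : ℝ≥0∞} (hη : η ≠ 0)
    (hηg : ∀ x, η ≤ g x)
    (hcurve : ∀ γ : Curve X, γ.Rectifiable → γ.length ≠ 0 → γ.toFun γ.left ∈ E →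
      γ.toFun γ.right ∈ F → 1 ≤ γ.lineIntegral g)
    {a : ℝ≥0∞} (ha0 : a ≠ 0) (ha : a < 1) :
    ∃ (f : X → ℝ) (φ : X → ℝ≥0∞) (r : ℝ), (∃ K, LipschitzWith K f) ∧ (∀ x, f x ∈ Icc (0 : ℝ) 1) ∧
      (∀ x ∈ E, f x = 0) ∧ (∀ x ∈ F, f x = 1) ∧ Continuous φ ∧ (∀ x, φ x ≤ a⁻¹ * g x) ∧
      (∀ x, φ x ≠ ∞) ∧ 0 < r ∧
      ∀ x y, dist x y ≤ r → f y - f x ≤ (φ x).toReal * dist x y := by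
  obtain ⟨n, hn⟩ := exists_le_coarseDist hE hF hEF hg hη hηg hcurve ha
  have hatop : a ≠ ∞ := (ha.trans ENNReal.one_lt_top).ne
  set r : ℝ := 1 / ((n : ℝ) + 1)
  have hr : 0 < r := by positivity
  set φ := lipschitzMinorant g (n + 1)
  have hφ : ∀ x, φ x ≤ (n + 1 : ℕ) := lipschitzMinorant_le_natCast g (n + 1)
  have hφtop : ∀ x, φ x ≠ ∞ := fun x => ne_top_of_le_ne_top (ENNReal.natCast_ne_top _) (hφ x)
  -- Truncation at `a` makes the possibly infinite coarse distance finite and equal to `a` on `F`;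
  -- division by `a` then gives boundary value `1`.
  let P : X → ℝ≥0∞ := fun x => min a (coarseDist E r φ x)
  have hPa : ∀ x, P x ≤ a := fun x => min_le_left _ _
  have hPtop : ∀ x, P x ≠ ∞ := fun x => ne_top_of_le_ne_top hatop (hPa x)
  have ha' : 0 < a.toReal := ENNReal.toReal_pos ha0 hatop
  have hinc : ∀ x y, dist x y ≤ r → P y ≤ P x + φ x * edist x y := by
    intro x y hxy
    rw [min_add]
    exact min_le_min le_self_add (coarseDist_le_add φ hxy)
  have hincr : ∀ x y, dist x y ≤ r → (P y).toReal / a.toReal - (P x).toReal / a.toReal ≤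
      (a⁻¹ * φ x).toReal * dist x y := by
    intro x y hxy
    have h1 := ENNReal.toReal_mono (ENNReal.add_ne_top.2 ⟨hPtop x,
      ENNReal.mul_ne_top (hφtop x) (edist_ne_top x y)⟩) (hinc x y hxy)
    rw [ENNReal.toReal_add (hPtop x) (ENNReal.mul_ne_top (hφtop x) (edist_ne_top x y)),
      ENNReal.toReal_mul, ← dist_edist] at h1
    rw [ENNReal.toReal_mul, ENNReal.toReal_inv, ← sub_div, mul_assoc, ← div_eq_inv_mul]
    gcongr
    linarith
  have hmem : ∀ x, (P x).toReal / a.toReal ∈ Icc (0 : ℝ) 1 := fun x =>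
    ⟨by positivity, (div_le_one ha').2 (ENNReal.toReal_mono hatop (hPa x))⟩
  have hainv : a⁻¹ ≠ ∞ := ENNReal.inv_ne_top.2 ha0
  refine ⟨fun x => (P x).toReal / a.toReal, fun x => a⁻¹ * φ x, r, ?_, hmem, ?_, ?_, ?_, ?_, ?_,
    hr, hincr⟩
  · refine exists_lipschitzWith_of_local hmem hr
      (C := (a⁻¹ * (n + 1 : ℕ)).toReal) ENNReal.toReal_nonneg fun x y hxy =>
      (hincr x y hxy).trans ?_
    gcongr
    · exact ENNReal.mul_ne_top hainv (ENNReal.natCast_ne_top _)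
    · exact hφ x
  · intro x hx
    simp [P, coarseDist_of_mem hr.le φ hx]
  · intro x hx
    simp only [P, min_eq_left (hn x hx)]
    exact div_self ha'.ne'
  · exact ENNReal.continuous_const_mul hainv |>.comp (continuous_lipschitzMinorant g (n + 1))
  · exact fun x => mul_le_mul_right (lipschitzMinorant_le g _ x) _
  · exact fun x => ENNReal.mul_ne_top hainv (hφtop x)

end LipschitzPotential

/-! ### Lipschitz functions are Newtonian -/

section LipschitzNewtonian

variable {X : Type*} [MetricSpace X] [MeasurableSpace X] [BorelSpace X]

theorem isUpperGradient_of_lipschitzWith {X : Type*} [MetricSpace X] [MeasurableSpace X]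
    {f : X → ℝ} {K : NNReal} (hf : LipschitzWith K f) :
    IsUpperGradient (fun x => (f x : EReal)) (fun _ => (K : ℝ≥0∞)) := by
  refine ⟨measurable_const, fun γ hγ _ => ?_⟩
  rw [UpperGradientOn, lineIntegral_const hγ, ← EReal.coe_sub, EReal.abs_def, ← Real.dist_eq,
    ← edist_dist]
  refine (hf _ _).trans ?_
  gcongr
  exact eVariationOn.edist_le _ γ.left_mem γ.right_mem

theorem memNewtonian_of_lipschitzWith {N p : ℝ} [IsFiniteMeasure (hausdorff N : Measure X)]
    (hp : 0 ≤ p) {f : X → ℝ} (hf : ∃ K, LipschitzWith K f) (hf1 : ∀ x, f x ∈ Icc (0 : ℝ) 1) :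
    MemNewtonian N p (fun x => (f x : EReal)) := by
  obtain ⟨K, hK⟩ := hf
  refine ⟨(measurable_coe_real_ereal.comp hK.continuous.measurable).aemeasurable, ?_, _,
    isUpperGradient_of_lipschitzWith hK, ?_⟩
  · refine lt_of_le_of_lt (lintegral_mono (g := fun _ => 1) fun x => ?_) ?_
    · refine ENNReal.rpow_le_one ?_ hp
      rw [EReal.abs_def, abs_of_nonneg (hf1 x).1]
      exact ENNReal.ofReal_le_one.2 (hf1 x).2
    · simp
  · rw [lintegral_const]
    exact ENNReal.mul_lt_top (ENNReal.rpow_lt_top_of_nonneg hp ENNReal.coe_ne_top)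
      (measure_lt_top _ _)

end LipschitzNewtonian

/-! ### Hausdorff measure by open covers -/

section OpenCovers

variable {X : Type*} [EMetricSpace X] [MeasurableSpace X] [BorelSpace X] {d : ℝ}

/-- The sum `∑ diam(U_n)^d` over the non-empty members of a family of sets. -/
def coverSum (d : ℝ) (U : ℕ → Set X) : ℝ≥0∞ :=
  ∑' n, ⨆ _ : (U n).Nonempty, Metric.ediam (U n) ^ d

theorem exists_cover_of_hausdorffMeasure_lt {s : Set X} {c : ℝ≥0∞}
    (h : μH[d] s < c) {r : ℝ≥0∞} (hr : 0 < r) :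
    ∃ U : ℕ → Set X, s ⊆ ⋃ n, U n ∧ (∀ n, Metric.ediam (U n) ≤ r) ∧ coverSum d U < c := by
  rw [Measure.hausdorffMeasure_apply] at h
  have h1 := lt_of_le_of_lt (le_iSup₂ (f := fun (r : ℝ≥0∞) (_ : 0 < r) =>
    ⨅ (t : ℕ → Set X) (_ : s ⊆ ⋃ n, t n) (_ : ∀ n, Metric.ediam (t n) ≤ r),
      ∑' n, ⨆ _ : (t n).Nonempty, Metric.ediam (t n) ^ d) r hr) h
  simpa only [iInf_lt_iff, exists_prop, coverSum] using h1

theorem hausdorffMeasure_le_of_covers {s : Set X} {c : ℝ≥0∞}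
    (h : ∀ r > 0, ∀ c' > c, ∃ U : ℕ → Set X, s ⊆ ⋃ n, U n ∧ (∀ n, Metric.ediam (U n) ≤ r) ∧
      coverSum d U ≤ c') : μH[d] s ≤ c := by
  rw [Measure.hausdorffMeasure_apply]
  refine iSup₂_le fun r hr => le_of_forall_gt_imp_ge_of_dense fun c' hc' => ?_
  obtain ⟨U, hU, hUr, hUc⟩ := h r hr c' hc'
  exact (iInf₂_le U hU).trans ((iInf_le _ hUr).trans hUc)

/-- Thicken each set of an efficient cover so slightly that the total increase of the sum stays
below the slack. Starting with diameters at most `r / 2` leaves room for the thickening. Openness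
makes a cover of one slice cover all nearby slices. -/
theorem exists_open_cover_of_hausdorffMeasure_lt (hd : 0 ≤ d) {s : Set X} {c : ℝ≥0∞}
    (h : μH[d] s < c) {r : ℝ≥0∞} (hr : 0 < r) :
    ∃ U : ℕ → Set X, (∀ n, IsOpen (U n)) ∧ s ⊆ ⋃ n, U n ∧ (∀ n, Metric.ediam (U n) ≤ r) ∧
      coverSum d U < c := by
  wlog hrt : r ≠ ∞ generalizing r
  · obtain ⟨U, h1, h2, h3, h4⟩ := this one_pos ENNReal.one_ne_top
    push Not at hrt
    exact ⟨U, h1, h2, fun n => by simp [hrt], h4⟩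
  obtain ⟨T, hT, hTr, hTc⟩ := exists_cover_of_hausdorffMeasure_lt h (ENNReal.half_pos hr.ne')
  obtain ⟨ε, hε, hεsum⟩ := ENNReal.exists_pos_sum_of_countable
    (tsub_pos_of_lt hTc).ne' ℕ
  have hδ : ∀ n, ∃ δ : ℝ, 0 < δ ∧ Metric.ediam (T n) + 2 * ENNReal.ofReal δ ≤ r ∧
      (Metric.ediam (T n) + 2 * ENNReal.ofReal δ) ^ d ≤ Metric.ediam (T n) ^ d + ε n := by
    intro n
    have hfin : Metric.ediam (T n) ≠ ∞ :=
      ne_top_of_le_ne_top (ENNReal.div_ne_top hrt two_ne_zero) (hTr n)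
    have hlt : Metric.ediam (T n) < r :=
      (hTr n).trans_lt (ENNReal.half_lt_self hr.ne' hrt)
    have hlim : Tendsto (fun δ : ℝ => Metric.ediam (T n) + 2 * ENNReal.ofReal δ) (𝓝[>] 0)
        (𝓝 (Metric.ediam (T n) + 2 * ENNReal.ofReal 0)) :=
      tendsto_const_nhds.add (ENNReal.Tendsto.const_mul
        (ENNReal.tendsto_ofReal (tendsto_id.mono_left nhdsWithin_le_nhds))
        (Or.inr ENNReal.ofNat_ne_top))
    rw [ENNReal.ofReal_zero, mul_zero, add_zero] at hlim
    have hlim2 := (ENNReal.continuous_rpow_const (y := d)).continuousAt.tendsto.comp hlim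
    have hlt2 : Metric.ediam (T n) ^ d < Metric.ediam (T n) ^ d + ε n :=
      ENNReal.lt_add_right (ENNReal.rpow_ne_top_of_nonneg hd hfin) (by exact_mod_cast (hε n).ne')
    obtain ⟨δ, ⟨h1, h2⟩, h3⟩ := ((hlim.eventually_lt_const hlt).and
      (hlim2.eventually_lt_const hlt2)).and self_mem_nhdsWithin |>.exists
    exact ⟨δ, h3, h1.le, h2.le⟩
  choose δ hδ0 hδr hδd using hδ
  have hth : ∀ n, Metric.ediam (Metric.thickening (δ n) (T n)) ≤
      Metric.ediam (T n) + 2 * ENNReal.ofReal (δ n) := fun n => by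
    have := Metric.ediam_thickening_le (s := T n) (Real.toNNReal (δ n))
    rwa [Real.coe_toNNReal _ (hδ0 n).le] at this
  refine ⟨fun n => Metric.thickening (δ n) (T n), fun n => Metric.isOpen_thickening,
    hT.trans (iUnion_mono fun n => Metric.self_subset_thickening (hδ0 n) _),
    fun n => (hth n).trans (hδr n), ?_⟩
  have hle : coverSum d (fun n => Metric.thickening (δ n) (T n)) ≤
      coverSum d T + ∑' n, (ε n : ℝ≥0∞) := by
    rw [coverSum, coverSum, ← ENNReal.tsum_add]
    refine ENNReal.tsum_le_tsum fun n => iSup_le fun hn => ?_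
    have hTn : (T n).Nonempty := by
      rw [nonempty_iff_ne_empty]
      intro h0
      simp [h0] at hn
    refine (ENNReal.rpow_le_rpow (hth n) hd).trans ((hδd n).trans ?_)
    gcongr
    exact le_iSup (fun _ : (T n).Nonempty => Metric.ediam (T n) ^ d) hTn
  calc _ ≤ coverSum d T + ∑' n, (ε n : ℝ≥0∞) := hle
    _ < coverSum d T + (c - coverSum d T) := by
        refine ENNReal.add_lt_add_left ?_ hεsum
        exact (hTc.trans_le le_top).ne
    _ = c := add_tsub_cancel_of_le hTc.le

end OpenCovers

/-! ### Measurable dependence of level sets on the level -/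

section Slices

variable {X : Type*} [EMetricSpace X] [CompactSpace X] [MeasurableSpace X] [BorelSpace X] {d : ℝ}
  {f : X → ℝ}

/-- By compactness, an open cover of one slice covers the slices at nearby levels. Hence the levels
admitting a fine open cover with sum below `c'` form an open set, and a sublevel set of the slice
measure is a countable intersection of such sets. -/
theorem measurable_hausdorffMeasure_slice (hd : 0 ≤ d) (hf : Continuous f) {K : Set X}
    (hK : IsClosed K) : Measurable fun t => μH[d] (K ∩ f ⁻¹' {t}) := by
  refine measurable_of_Iic fun c => ?_
  rcases eq_or_ne c ∞ with rfl | hc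
  · simp
  let W : ℝ≥0∞ → ℝ≥0∞ → Set ℝ := fun r c' => {t | ∃ U : ℕ → Set X, (∀ n, IsOpen (U n)) ∧
    K ∩ f ⁻¹' {t} ⊆ ⋃ n, U n ∧ (∀ n, Metric.ediam (U n) ≤ r) ∧ coverSum d U < c'}
  have hW : ∀ r c', IsOpen (W r c') := by
    intro r c'
    refine isOpen_iff_mem_nhds.2 ?_
    rintro t ⟨U, hU, hcov, hr, hsum⟩
    have hcomp : IsClosed (f '' (K \ ⋃ n, U n)) :=
      ((hK.sdiff (isOpen_iUnion hU)).isCompact.image hf).isClosed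
    have ht : t ∈ (f '' (K \ ⋃ n, U n))ᶜ := by
      rintro ⟨x, ⟨hxK, hxU⟩, hxt⟩
      exact hxU (hcov ⟨hxK, hxt⟩)
    filter_upwards [hcomp.isOpen_compl.mem_nhds ht] with t' ht'
    refine ⟨U, hU, fun x hx => ?_, hr, hsum⟩
    by_contra hxU
    exact ht' ⟨x, ⟨hx.1, hxU⟩, hx.2⟩
  have heq : (fun t => μH[d] (K ∩ f ⁻¹' {t})) ⁻¹' Iic c =
      ⋂ n : ℕ, W ((n : ℝ≥0∞) + 1)⁻¹ (c + ((n : ℝ≥0∞) + 1)⁻¹) := by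
    have hpos : ∀ n : ℕ, 0 < ((n : ℝ≥0∞) + 1)⁻¹ := fun n => by
      rw [ENNReal.inv_pos]
      exact ENNReal.add_ne_top.2 ⟨ENNReal.natCast_ne_top n, ENNReal.one_ne_top⟩
    have hlim : Tendsto (fun n : ℕ => ((n : ℝ≥0∞) + 1)⁻¹) atTop (𝓝 0) := by
      have := (tendsto_add_atTop_iff_nat 1).2 ENNReal.tendsto_inv_nat_nhds_zero
      simpa using this
    ext t
    simp only [mem_preimage, mem_Iic, mem_iInter]
    constructor
    · intro h n
      exact exists_open_cover_of_hausdorffMeasure_lt hd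
        (h.trans_lt (ENNReal.lt_add_right hc (hpos n).ne')) (hpos n)
    · intro h
      refine hausdorffMeasure_le_of_covers fun r hr c' hc' => ?_
      have hlim2 : Tendsto (fun n : ℕ => c + ((n : ℝ≥0∞) + 1)⁻¹) atTop (𝓝 (c + 0)) :=
        tendsto_const_nhds.add hlim
      rw [add_zero] at hlim2
      obtain ⟨n, h1, h2⟩ := ((hlim.eventually_lt_const hr).and
        (hlim2.eventually_lt_const hc')).exists
      obtain ⟨U, -, hcov, hdiam, hsum⟩ := h n
      exact ⟨U, hcov, fun k => (hdiam k).trans h1.le, (hsum.trans h2).le⟩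
  rw [heq]
  exact MeasurableSet.iInter fun n => (hW _ _).measurableSet

/-- The restrictions of a Hausdorff measure to the level sets of a continuous function depend
measurably on the level if almost all of them are finite. -/
theorem aemeasurable_restrict_level (hd : 0 ≤ d) (hf : Continuous f)
    (hfin : ∀ᵐ t : ℝ, μH[d] (f ⁻¹' {t}) ≠ ∞) :
    AEMeasurable (fun t : ℝ => (μH[d] : Measure X).restrict (f ⁻¹' {t})) := by
  have hmeas : ∀ K : Set X, IsClosed K → Measurable fun t => μH[d] (K ∩ f ⁻¹' {t}) :=
    fun K hK => measurable_hausdorffMeasure_slice hd hf hK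
  have huniv : Measurable fun t => μH[d] (f ⁻¹' {t}) := by
    simpa using hmeas univ isClosed_univ
  let B : Set ℝ := {t | μH[d] (f ⁻¹' {t}) = ∞}
  have hB : MeasurableSet B := huniv (measurableSet_singleton ∞)
  classical
  -- Discarding the levels of infinite measure makes every `κ t` finite, so measurability can be
  -- tested on the π-system of closed sets.
  let κ : ℝ → Measure X := fun t => if t ∈ B then 0 else (μH[d] : Measure X).restrict (f ⁻¹' {t})
  have hκfin : ∀ t, IsFiniteMeasure (κ t) := by
    intro t
    by_cases ht : t ∈ B
    · simp only [κ, if_pos ht]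
      infer_instance
    · simp only [κ, if_neg ht]
      exact ⟨by rw [Measure.restrict_apply_univ]; exact lt_top_iff_ne_top.2 ht⟩
  have happ : ∀ K : Set X, IsClosed K → Measurable fun t => κ t K := by
    intro K hK
    have : (fun t => κ t K) = fun t => if t ∈ B then 0 else μH[d] (K ∩ f ⁻¹' {t}) := by
      ext t
      by_cases ht : t ∈ B
      · simp [κ, ht]
      · simp only [κ, if_neg ht, Measure.restrict_apply hK.measurableSet]
    rw [this]
    exact Measurable.ite hB measurable_const (hmeas K hK)
  have hκ : Measurable κ :=
    Measurable.measure_of_isPiSystem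
      (BorelSpace.measurable_eq.trans (borel_eq_generateFrom_isClosed (α := X))) isPiSystem_isClosed
      (fun K hK => happ K hK) (happ univ isClosed_univ)
  refine ⟨κ, hκ, ?_⟩
  filter_upwards [hfin] with t ht
  simp only [κ, B, mem_ofPred_eq, if_neg ht]

end Slices

/-! ### Eilenberg's inequality -/

section Eilenberg

variable {X : Type*} [EMetricSpace X] [MeasurableSpace X] [BorelSpace X] {d : ℝ} {f : X → ℝ}

/-- Eilenberg's inequality for a function that is Lipschitz on small subsets of `A`. -/
theorem lintegral_hausdorffMeasure_slice_le (hd : 0 ≤ d) {A : Set X} (hA : μH[d + 1] A ≠ ∞)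
    {c r : ℝ≥0∞} (hc : c ≠ ∞) (hr : 0 < r)
    (hf : ∀ x ∈ A, ∀ y ∈ A, edist x y ≤ r → edist (f x) (f y) ≤ c * edist x y) :
    ∫⁻ t : ℝ, μH[d] (A ∩ f ⁻¹' {t}) ≤ c * μH[d + 1] A := by
  have hpos : ∀ n : ℕ, 0 < ((n : ℝ≥0∞) + 1)⁻¹ := fun n => by
    rw [ENNReal.inv_pos]
    exact ENNReal.add_ne_top.2 ⟨ENNReal.natCast_ne_top n, ENNReal.one_ne_top⟩
  have hlim : Tendsto (fun n : ℕ => ((n : ℝ≥0∞) + 1)⁻¹) atTop (𝓝 0) := by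
    have := (tendsto_add_atTop_iff_nat 1).2 ENNReal.tendsto_inv_nat_nhds_zero
    simpa using this
  have hex : ∀ j : ℕ, ∃ T : ℕ → Set X, A ⊆ ⋃ n, T n ∧
      (∀ n, Metric.ediam (T n) ≤ min r ((j : ℝ≥0∞) + 1)⁻¹) ∧
      coverSum (d + 1) T < μH[d + 1] A + ((j : ℝ≥0∞) + 1)⁻¹ := fun j =>
    exists_cover_of_hausdorffMeasure_lt (ENNReal.lt_add_right hA (hpos j).ne')
      (lt_min hr (hpos j))
  choose T hcov hdiam hsum using hex
  let S : ℕ → ℕ → Set X := fun j n => T j n ∩ A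
  -- The images need not be measurable, so a measurable hull of the same measure is used.
  let I : ℕ → ℕ → Set ℝ := fun j n => toMeasurable volume (f '' S j n)
  let h : ℕ → ℝ → ℝ≥0∞ := fun j t =>
    ∑' n, (I j n).indicator (fun _ => Metric.ediam (S j n) ^ d) t
  have hSdiam : ∀ j n, Metric.ediam (S j n) ≤ min r ((j : ℝ≥0∞) + 1)⁻¹ := fun j n =>
    (Metric.ediam_mono inter_subset_left).trans (hdiam j n)
  have hm : ∀ j, Measurable (h j) := fun j =>
    Measurable.tsum fun n => measurable_const.indicator (measurableSet_toMeasurable _ _)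
  -- The traces on level `t` of the `j`-th cover form a cover whose sum is at most `h j t`.
  -- Integrating `h j` replaces one factor of diameter by the length of an image under `f`, and
  -- Fatou's lemma concludes.
  have hslice : ∀ t : ℝ, μH[d] (A ∩ f ⁻¹' {t}) ≤ liminf (fun j => h j t) atTop := by
    intro t
    rw [Measure.hausdorffMeasure_apply]
    refine iSup₂_le fun δ hδ => ?_
    refine le_liminf_of_le (by isBoundedDefault) ?_
    filter_upwards [hlim.eventually_lt_const hδ] with j hj
    refine (iInf₂_le (fun n => S j n ∩ f ⁻¹' {t}) ?_).trans ((iInf_le _ fun n => ?_).trans ?_)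
    · rintro x ⟨hxA, hxt⟩
      obtain ⟨n, hn⟩ := mem_iUnion.1 (hcov j hxA)
      exact mem_iUnion.2 ⟨n, ⟨hn, hxA⟩, hxt⟩
    · exact (Metric.ediam_mono inter_subset_left).trans
        ((hSdiam j n).trans ((min_le_right _ _).trans hj.le))
    · refine ENNReal.tsum_le_tsum fun n => iSup_le fun hn => ?_
      obtain ⟨x, hx, hxt⟩ := hn
      have ht : t ∈ I j n := subset_toMeasurable _ _ ⟨x, hx, hxt⟩
      rw [indicator_of_mem ht]
      exact ENNReal.rpow_le_rpow (Metric.ediam_mono inter_subset_left) hd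
  have hint : ∀ j, ∫⁻ t, h j t ≤ c * (μH[d + 1] A + ((j : ℝ≥0∞) + 1)⁻¹) := by
    intro j
    rw [lintegral_tsum fun n =>
      (measurable_const.indicator (measurableSet_toMeasurable _ _)).aemeasurable]
    have hterm : ∀ n, ∫⁻ t, (I j n).indicator (fun _ => Metric.ediam (S j n) ^ d) t ≤
        c * ⨆ _ : (T j n).Nonempty, Metric.ediam (T j n) ^ (d + 1) := by
      intro n
      rw [lintegral_indicator_const (measurableSet_toMeasurable _ _), measure_toMeasurable]
      rcases (S j n).eq_empty_or_nonempty with h0 | h0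
      · simp [h0]
      have himg : Metric.ediam (f '' S j n) ≤ c * Metric.ediam (S j n) := by
        refine Metric.ediam_image_le_iff.2 fun x hx y hy => ?_
        have hxy : edist x y ≤ Metric.ediam (S j n) := Metric.edist_le_ediam_of_mem hx hy
        refine (hf x hx.2 y hy.2 (hxy.trans ((hSdiam j n).trans (min_le_left _ _)))).trans ?_
        gcongr
      have hT : (T j n).Nonempty := h0.mono inter_subset_left
      calc Metric.ediam (S j n) ^ d * volume (f '' S j n)
          ≤ Metric.ediam (S j n) ^ d * (c * Metric.ediam (S j n)) := by
            gcongr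
            exact (Real.volume_le_diam _).trans himg
        _ = c * Metric.ediam (S j n) ^ (d + 1) := by
            rw [ENNReal.rpow_add_of_nonneg _ _ hd zero_le_one, ENNReal.rpow_one]
            ring
        _ ≤ c * Metric.ediam (T j n) ^ (d + 1) := by
            gcongr
            exact inter_subset_left
        _ ≤ _ := by
            gcongr
            exact le_iSup (fun _ : (T j n).Nonempty => Metric.ediam (T j n) ^ (d + 1)) hT
    refine (ENNReal.tsum_le_tsum hterm).trans ?_
    rw [ENNReal.tsum_mul_left]
    gcongr
    exact (hsum j).le
  have hlim2 : Tendsto (fun j : ℕ => c * (μH[d + 1] A + ((j : ℝ≥0∞) + 1)⁻¹)) atTop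
      (𝓝 (c * (μH[d + 1] A + 0))) :=
    ENNReal.Tendsto.const_mul (tendsto_const_nhds.add hlim) (Or.inr hc)
  rw [add_zero] at hlim2
  calc ∫⁻ t : ℝ, μH[d] (A ∩ f ⁻¹' {t}) ≤ ∫⁻ t, liminf (fun j => h j t) atTop :=
        lintegral_mono hslice
    _ ≤ liminf (fun j => ∫⁻ t, h j t) atTop := lintegral_liminf_le hm
    _ ≤ liminf (fun j : ℕ => c * (μH[d + 1] A + ((j : ℝ≥0∞) + 1)⁻¹)) atTop :=
        liminf_le_liminf (Eventually.of_forall hint)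
    _ = _ := hlim2.liminf_eq

end Eilenberg

/-! ### From local bounds to a density -/

section Density

variable {α : Type*} [MeasurableSpace α]

/-- A measure that is at most `c • μ` on the sets where `φ ≤ c` has density at most `φ`. -/
theorem le_withDensity_of_le_mul {μ ν : Measure α} [IsFiniteMeasure μ] {φ : α → ℝ≥0∞}
    (hφ : Measurable φ) (hfin : ∀ x, φ x ≠ ∞)
    (h : ∀ c : ℝ≥0∞, c ≠ ∞ → ∀ A, MeasurableSet A → (∀ x ∈ A, φ x ≤ c) → ν A ≤ c * μ A) :
    ν ≤ μ.withDensity φ := by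
  refine Measure.le_iff.2 fun A hA => ?_
  rw [withDensity_apply _ hA]
  have key : ∀ ε : ℝ, 0 < ε → ν A ≤ ∫⁻ x in A, φ x ∂μ + ENNReal.ofReal ε * μ univ := by
    intro ε hε
    -- The layers `n * ε ≤ φ < (n + 1) * ε`; on each, the constant `c = (n + 1) * ε` exceeds `φ` by
    -- at most `ε`.
    let k : α → ℕ := fun x => ⌊(φ x).toReal / ε⌋₊
    have hk : Measurable k := (hφ.ennreal_toReal.div_const ε).nat_floor
    have hAk : ∀ n, MeasurableSet (A ∩ k ⁻¹' {n}) := fun n =>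
      hA.inter (hk (measurableSet_singleton n))
    have hdisj : Pairwise (Function.onFun Disjoint fun n => A ∩ k ⁻¹' {n}) := by
      intro m n hmn
      refine Set.disjoint_left.2 fun x hx hx' => hmn ?_
      exact hx.2.symm.trans hx'.2
    have hun : ⋃ n, A ∩ k ⁻¹' {n} = A := by
      rw [← inter_iUnion, ← preimage_iUnion, iUnion_of_singleton, preimage_univ, inter_univ]
    have hpiece : ∀ n, ν (A ∩ k ⁻¹' {n}) ≤ ∫⁻ x in A ∩ k ⁻¹' {n}, (φ x + ENNReal.ofReal ε) ∂μ := by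
      intro n
      have h1 : ∀ x ∈ A ∩ k ⁻¹' {n}, φ x ≤ ENNReal.ofReal ((n + 1) * ε) := by
        rintro x ⟨-, hx⟩
        have hx : k x = n := hx
        rw [ENNReal.le_ofReal_iff_toReal_le (hfin x) (by positivity)]
        have := Nat.lt_floor_add_one ((φ x).toReal / ε)
        rw [div_lt_iff₀ hε] at this
        rw [← hx]
        exact this.le
      have h2 : ∀ x ∈ A ∩ k ⁻¹' {n}, ENNReal.ofReal ((n + 1) * ε) ≤ φ x + ENNReal.ofReal ε := by
        rintro x ⟨-, hx⟩
        have hx : k x = n := hx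
        rw [add_mul, one_mul, ENNReal.ofReal_add (by positivity) hε.le]
        gcongr
        rw [ENNReal.ofReal_le_iff_le_toReal (hfin x)]
        have : (⌊(φ x).toReal / ε⌋₊ : ℝ) ≤ (φ x).toReal / ε := Nat.floor_le (by positivity)
        rw [le_div_iff₀ hε] at this
        rw [← hx]
        exact this
      refine (h _ ENNReal.ofReal_ne_top _ (hAk n) h1).trans ?_
      rw [← setLIntegral_const]
      exact setLIntegral_mono' (hAk n) h2
    calc ν A = ∑' n, ν (A ∩ k ⁻¹' {n}) := by rw [← measure_iUnion hdisj hAk, hun]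
      _ ≤ ∑' n, ∫⁻ x in A ∩ k ⁻¹' {n}, (φ x + ENNReal.ofReal ε) ∂μ := ENNReal.tsum_le_tsum hpiece
      _ = ∫⁻ x in A, (φ x + ENNReal.ofReal ε) ∂μ := by
          rw [← lintegral_iUnion hAk hdisj, hun]
      _ = ∫⁻ x in A, φ x ∂μ + ENNReal.ofReal ε * μ A := by
          rw [lintegral_add_right _ measurable_const, setLIntegral_const]
      _ ≤ _ := by
          gcongr
          exact subset_univ A
  have hlim : Tendsto (fun ε : ℝ => ∫⁻ x in A, φ x ∂μ + ENNReal.ofReal ε * μ univ) (𝓝[>] 0)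
      (𝓝 (∫⁻ x in A, φ x ∂μ + ENNReal.ofReal 0 * μ univ)) := by
    refine tendsto_const_nhds.add (ENNReal.Tendsto.mul_const ?_ (Or.inr (measure_ne_top μ univ)))
    exact ENNReal.tendsto_ofReal (tendsto_id.mono_left nhdsWithin_le_nhds)
  rw [ENNReal.ofReal_zero, zero_mul, add_zero] at hlim
  exact ge_of_tendsto hlim (by filter_upwards [self_mem_nhdsWithin] with ε hε using key ε hε)

end Density

/-! ### Frontiers of sublevel sets and the coarea inequality -/

section LevelSets

variable {X : Type*} [MetricSpace X] {f : X → ℝ}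

/-- A point at level `t` is a limit of points of smaller value exactly when it is not a local
minimum. The frontiers are thus slices of one fixed set, which reduces measurability in `t` to that
of the level sets. -/
theorem frontier_sublevel_eq (hf : Continuous f) (t : ℝ) :
    frontier {y | f y < t} = {x | ¬ IsLocalMin f x} ∩ f ⁻¹' {t} := by
  have hopen : IsOpen {y | f y < t} := isOpen_lt hf continuous_const
  rw [frontier, hopen.interior_eq]
  ext x
  rw [Set.mem_sdiff]
  simp only [mem_inter_iff, mem_ofPred_eq, mem_preimage, mem_singleton_iff]
  constructor
  · rintro ⟨hcl, hx⟩
    have hx : t ≤ f x := not_lt.1 hx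
    have hle : f x ≤ t := by
      have : closure {y | f y < t} ⊆ {y | f y ≤ t} := closure_lt_subset_le hf continuous_const
      exact this hcl
    have heq := le_antisymm hle hx
    refine ⟨fun hmin => ?_, heq⟩
    obtain ⟨y, hy1, hy2⟩ := mem_closure_iff_nhds.1 hcl _ hmin
    have hy1 : f x ≤ f y := hy1
    have hy2 : f y < t := hy2
    linarith
  · rintro ⟨hmin, rfl⟩
    refine ⟨mem_closure_iff_nhds.2 fun V hV => ?_, lt_irrefl (f x)⟩
    by_contra hne
    refine hmin ?_
    filter_upwards [hV] with y hy
    by_contra hlt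
    exact hne ⟨y, hy, not_le.1 hlt⟩

/-- Minimality on a ball of fixed radius is a closed condition on the center, so the local minima
form a countable union of closed sets. -/
theorem measurableSet_not_isLocalMin [MeasurableSpace X] [BorelSpace X] (hf : Continuous f) :
    MeasurableSet {x | ¬ IsLocalMin f x} := by
  have heq : {x | IsLocalMin f x} =
      ⋃ n : ℕ, ⋂ y, {x | 1 / ((n : ℝ) + 1) ≤ dist y x} ∪ {x | f x ≤ f y} := by
    ext x
    simp only [mem_ofPred_eq, mem_iUnion, mem_iInter, mem_union]
    constructor
    · intro h
      obtain ⟨ε, hε, hball⟩ := Metric.mem_nhds_iff.1 h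
      obtain ⟨n, hn⟩ := exists_nat_one_div_lt hε
      refine ⟨n, fun y => or_iff_not_imp_left.2 fun hy => ?_⟩
      exact hball (lt_trans (not_le.1 hy) hn)
    · rintro ⟨n, hn⟩
      have hpos : (0 : ℝ) < 1 / ((n : ℝ) + 1) := by positivity
      filter_upwards [Metric.ball_mem_nhds x hpos] with y hy
      exact (hn y).resolve_left (not_le.2 hy)
  have hclosed : MeasurableSet {x | IsLocalMin f x} := by
    rw [heq]
    refine MeasurableSet.iUnion fun n => (isClosed_iInter fun y => ?_).measurableSet
    exact (isClosed_le continuous_const (continuous_const.dist continuous_id)).union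
      (isClosed_le hf continuous_const)
  exact hclosed.compl

variable [CompactSpace X] [MeasurableSpace X] [BorelSpace X] {d : ℝ}

/-- The coarea inequality for a Lipschitz function whose increments on small scales are controlled
by a continuous function `φ`. -/
theorem coarea_frontier_le (hd : 0 ≤ d) (hfin : μH[d + 1] (univ : Set X) ≠ ∞)
    (hf : ∃ K, LipschitzWith K f) {φ : X → ℝ≥0∞} (hφ : Continuous φ) (hφfin : ∀ x, φ x ≠ ∞)
    {r : ℝ} (hr : 0 < r)
    (hinc : ∀ x y, dist x y ≤ r → f y - f x ≤ (φ x).toReal * dist x y)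
    {ρ : X → ℝ≥0∞} (hρ : Measurable ρ) :
    AEMeasurable (fun t : ℝ => ∫⁻ x in frontier {y | f y < t}, ρ x ∂μH[d]) ∧
    ∫⁻ t : ℝ, ∫⁻ x in frontier {y | f y < t}, ρ x ∂μH[d] ≤ ∫⁻ x, ρ x * φ x ∂μH[d + 1] := by
  obtain ⟨K, hK⟩ := hf
  have hcont := hK.continuous
  have hlevel : Measurable fun t => μH[d] (f ⁻¹' {t}) := by
    simpa using measurable_hausdorffMeasure_slice hd hcont isClosed_univ
  -- Eilenberg's inequality with the global Lipschitz constant.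
  have hae : ∀ᵐ t : ℝ, μH[d] (f ⁻¹' {t}) ≠ ∞ := by
    have h1 := lintegral_hausdorffMeasure_slice_le hd hfin (c := K) (f := f) ENNReal.coe_ne_top
      one_pos fun x _ y _ _ => hK x y
    simp only [univ_inter] at h1
    filter_upwards [ae_lt_top hlevel
      (ne_top_of_le_ne_top (ENNReal.mul_ne_top ENNReal.coe_ne_top hfin) h1)] with t ht using ht.ne
  have hκ := aemeasurable_restrict_level hd hcont hae
  set κ : ℝ → Measure X := fun t => (μH[d] : Measure X).restrict (f ⁻¹' {t})
  have hM := measurableSet_not_isLocalMin hcont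
  have hfront : ∀ t : ℝ, ∫⁻ x in frontier {y | f y < t}, ρ x ∂μH[d] =
      ∫⁻ x, {x | ¬ IsLocalMin f x}.indicator ρ x ∂κ t := by
    intro t
    rw [lintegral_indicator hM, Measure.restrict_restrict hM, frontier_sublevel_eq hcont]
  simp only [hfront]
  have hρM : Measurable ({x | ¬ IsLocalMin f x}.indicator ρ) := hρ.indicator hM
  refine ⟨(Measure.measurable_lintegral hρM).comp_aemeasurable hκ, ?_⟩
  rw [← Measure.lintegral_bind hκ hρM.aemeasurable]
  have : IsFiniteMeasure (μH[d + 1] : Measure X) := ⟨lt_top_iff_ne_top.2 hfin⟩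
  -- The left side gives `A` the integral over `t` of the measure of its slices. Where `φ ≤ c` on
  -- `A`, increments are bounded by `c` in both directions, so Eilenberg's inequality applies with
  -- constant `c`.
  have hle : volume.bind κ ≤ (μH[d + 1] : Measure X).withDensity φ := by
    refine le_withDensity_of_le_mul hφ.measurable hφfin fun c hc A hA hAc => ?_
    rw [Measure.bind_apply hA hκ]
    simp only [κ, Measure.restrict_apply hA]
    refine lintegral_hausdorffMeasure_slice_le hd (measure_ne_top _ _) hc
      (ENNReal.ofReal_pos.2 hr) fun x hx y hy hxy => ?_
    have hdist : dist x y ≤ r := by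
      rwa [edist_dist, ENNReal.ofReal_le_ofReal_iff hr.le] at hxy
    have hb : ∀ z ∈ A, (φ z).toReal ≤ c.toReal := fun z hz => ENNReal.toReal_mono hc (hAc z hz)
    have h1 := (hinc x y hdist).trans (mul_le_mul_of_nonneg_right (hb x hx) dist_nonneg)
    have h2 := (hinc y x (by rwa [dist_comm])).trans
      (mul_le_mul_of_nonneg_right (hb y hy) dist_nonneg)
    rw [dist_comm y x] at h2
    rw [edist_dist, edist_dist, ← ENNReal.ofReal_toReal hc, ← ENNReal.ofReal_mul
      ENNReal.toReal_nonneg, Real.dist_eq]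
    exact ENNReal.ofReal_le_ofReal (abs_le.2 ⟨by linarith, h2⟩)
  refine (lintegral_mono' hle (indicator_le_self _ ρ)).trans (le_of_eq ?_)
  rw [lintegral_withDensity_eq_lintegral_mul _ hφ.measurable hρ]
  simp only [Pi.mul_apply, mul_comm]

end LevelSets

/-! ### Hölder's inequality -/

section Hoelder

variable {α : Type*} [MeasurableSpace α] {μ : Measure α}

/-- Hölder's inequality for extended nonnegative functions and extended exponents. -/
theorem lintegral_mul_le_eLpNorm_mul {p : ℝ} (hp : 1 ≤ p) {q : ℝ≥0∞}
    (hpq : ENNReal.HolderConjugate (ENNReal.ofReal p) q) {ρ e : α → ℝ≥0∞} (hρ : Measurable ρ)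
    (he : Measurable e) :
    ∫⁻ x, ρ x * e x ∂μ ≤ eLpNorm ρ q μ * (∫⁻ x, e x ^ p ∂μ) ^ (1 / p) := by
  have hp0 : 0 < p := zero_lt_one.trans_le hp
  rcases eq_or_ne q ∞ with rfl | hq
  · have h1 : ENNReal.ofReal p = 1 := by
      have := hpq.inv_add_inv_eq_inv
      simpa using this
    have hp1 : p = 1 := by simpa using h1
    subst hp1
    simp only [ENNReal.rpow_one, div_one, eLpNorm_exponent_top]
    rw [← lintegral_const_mul _ he]
    refine lintegral_mono_ae ?_
    filter_upwards [enorm_ae_le_eLpNormEssSup ρ μ] with x hx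
    gcongr
    simpa using hx
  · have hreal : p.HolderConjugate q.toReal := by
      have := ENNReal.HolderConjugate.toReal_of_ne_top ENNReal.ofReal_ne_top hq (p := ENNReal.ofReal p)
      rwa [ENNReal.toReal_ofReal hp0.le] at this
    have hq0 : q ≠ 0 := fun h => by simpa [h] using hreal.symm.pos
    have := ENNReal.lintegral_mul_le_Lp_mul_Lq μ hreal.symm hρ.aemeasurable he.aemeasurable
    rw [eLpNorm_eq_lintegral_rpow_enorm_toReal hq0 hq]
    simpa using this

end Hoelder

theorem ballVol_pos {k : ℝ} (hk : 0 ≤ k) : 0 < ballVol k :=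
  div_pos (Real.rpow_pos_of_pos Real.pi_pos _) (Real.Gamma_pos_of_pos (by positivity))

/-! ### Normalized measures and the approximating functions -/

section Normalized

variable {X : Type*} [MetricSpace X] [CompactSpace X] [MeasurableSpace X] [BorelSpace X]

/-- The coarea inequality for the normalized Hausdorff measures. -/
theorem coarea_frontier_hausdorff_le {N : ℝ} (hN : 1 ≤ N) (hfin : hausdorff N (univ : Set X) < ∞)
    {f : X → ℝ} (hf : ∃ K, LipschitzWith K f) {φ : X → ℝ≥0∞} (hφ : Continuous φ)
    (hφfin : ∀ x, φ x ≠ ∞) {r : ℝ} (hr : 0 < r)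
    (hinc : ∀ x y, dist x y ≤ r → f y - f x ≤ (φ x).toReal * dist x y)
    {ρ : X → ℝ≥0∞} (hρ : Measurable ρ) :
    AEMeasurable (fun t : ℝ => ∫⁻ x in frontier {y | f y < t}, ρ x ∂(hausdorff (N - 1))) ∧
    ∫⁻ t : ℝ, ∫⁻ x in frontier {y | f y < t}, ρ x ∂(hausdorff (N - 1)) ≤
      ENNReal.ofReal (2 * ballVol (N - 1) / ballVol N) * ∫⁻ x, ρ x * φ x ∂(hausdorff N) := by
  have hv := ballVol_pos (zero_le_one.trans hN)
  have hv' := ballVol_pos (sub_nonneg.2 hN)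
  set c := ENNReal.ofReal (ballVol (N - 1) / 2 ^ (N - 1)) with hc
  set C := ENNReal.ofReal (ballVol N / 2 ^ N)
  have hC0 : C ≠ 0 := (ENNReal.ofReal_pos.2 (by positivity)).ne'
  have hd : μH[N - 1 + 1] = (μH[N] : Measure X) := by rw [sub_add_cancel]
  have hfin' : μH[N - 1 + 1] (univ : Set X) ≠ ∞ := by
    rw [hd]
    intro h
    rw [hausdorff, Measure.smul_apply, smul_eq_mul, h, ENNReal.mul_top hC0] at hfin
    exact hfin.ne rfl
  have hmul : ∀ t : ℝ, ∫⁻ x in frontier {y | f y < t}, ρ x ∂(hausdorff (N - 1)) =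
      c * ∫⁻ x in frontier {y | f y < t}, ρ x ∂μH[N - 1] := fun t => by
    rw [hausdorff, Measure.restrict_smul, lintegral_smul_measure, smul_eq_mul]
  obtain ⟨hm, hle⟩ := coarea_frontier_le (sub_nonneg.2 hN) hfin' hf hφ hφfin hr hinc hρ
  simp only [hmul]
  refine ⟨hm.const_mul c, ?_⟩
  rw [lintegral_const_mul'' _ hm, hausdorff, lintegral_smul_measure, smul_eq_mul, ← mul_assoc]
  rw [hd] at hle
  -- The factor `2` is the quotient of `2^N` by `2^(N - 1)` in the two normalizations.
  refine mul_le_mul' (le_of_eq ?_) hle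
  rw [hc, ← ENNReal.ofReal_mul (by positivity)]
  congr 1
  have h2 : (2 : ℝ) ^ N = 2 ^ (N - 1) * 2 := by
    rw [← Real.rpow_add_one two_ne_zero, sub_add_cancel]
  rw [h2]
  have : (0 : ℝ) < 2 ^ (N - 1) := by positivity
  field_simp

/-- Upper gradients of a function with boundary values `0` and `1` are at least `1` on connecting
curves. -/
theorem IsUpperGradient.one_le_lineIntegral {X : Type*} [MetricSpace X] [MeasurableSpace X]
    {u : X → EReal} {g : X → ℝ≥0∞}
    (h : IsUpperGradient u g) {γ : Curve X} (hγ : γ.Rectifiable) (hγ0 : γ.length ≠ 0)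
    (h0 : u (γ.toFun γ.left) = 0) (h1 : u (γ.toFun γ.right) = 1) : 1 ≤ γ.lineIntegral g := by
  have := h.2 γ hγ hγ0
  rw [UpperGradientOn, h0, h1, zero_sub, EReal.abs_neg] at this
  refine le_trans (le_of_eq ?_) this
  rw [← EReal.coe_one, EReal.abs_def]
  simp

/-- Lipschitz functions with the boundary values of `u` whose local Lipschitz constants are
controlled by a function close to `g`. -/
theorem exists_lipschitz_of_upperGradientOutside {N p : ℝ} (hp : 1 ≤ p)
    (hX : hausdorff N (univ : Set X) < ∞) {E F : Set X} (hE : IsClosed E) (hF : IsClosed F)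
    (hEF : Disjoint E F) {u : X → EReal} (huE : ∀ x ∈ E, u x = 0) (huF : ∀ x ∈ F, u x = 1)
    {g σ : X → ℝ≥0∞} (hout : UpperGradientOutside u g σ)
    (hg : ∫⁻ x, g x ^ p ∂(hausdorff N) < ∞) (hσ : ∫⁻ x, σ x ^ p ∂(hausdorff N) < ∞)
    {ε : ℝ≥0∞} (hε : ε ≠ 0) (hεtop : ε ≠ ∞) :
    ∃ (f : X → ℝ) (φ e : X → ℝ≥0∞) (r : ℝ), (∃ K, LipschitzWith K f) ∧
      (∀ x, f x ∈ Icc (0 : ℝ) 1) ∧ (∀ x ∈ E, f x = 0) ∧ (∀ x ∈ F, f x = 1) ∧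
      Continuous φ ∧ (∀ x, φ x ≠ ∞) ∧ 0 < r ∧
      (∀ x y, dist x y ≤ r → f y - f x ≤ (φ x).toReal * dist x y) ∧
      Measurable e ∧ ∫⁻ x, e x ^ p ∂(hausdorff N) ≤ ε ^ p ∧
      ∀ x, φ x ≤ (1 + ε) * (g x + ε * σ x + ε + e x) := by
  have hp0 : 0 < p := zero_lt_one.trans_le hp
  have : IsFiniteMeasure (hausdorff N : Measure X) := ⟨hX⟩
  have hug := hout.isUpperGradient hε
  have hfin1 : ∫⁻ x, (g x + ε * σ x) ^ p ∂(hausdorff N) < ∞ := by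
    refine ENNReal.lintegral_rpow_add_lt_top_of_lintegral_rpow_lt_top hout.1.aemeasurable hg ?_ hp
    simp only [ENNReal.mul_rpow_of_nonneg _ _ hp0.le]
    rw [lintegral_const_mul _ (hout.2.1.pow_const p)]
    exact ENNReal.mul_lt_top (ENNReal.rpow_lt_top_of_nonneg hp0.le hεtop) hσ
  have hfin : ∫⁻ x, (g x + ε * σ x + ε) ^ p ∂(hausdorff N) < ∞ := by
    refine ENNReal.lintegral_rpow_add_lt_top_of_lintegral_rpow_lt_top
      hug.1.aemeasurable hfin1 ?_ hp
    rw [lintegral_const]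
    exact ENNReal.mul_lt_top (ENNReal.rpow_lt_top_of_nonneg hp0.le hεtop) (measure_lt_top _ _)
  -- The summand `ε` supplies the positive lower bound that keeps cheap coarse curves of bounded
  -- length.
  obtain ⟨h, e, hlsc, hle, hem, heq, hei⟩ := exists_lowerSemicontinuous_rpow
    (μ := hausdorff N) hp (hug.1.add_const ε) hfin.ne
    (ENNReal.rpow_pos (pos_iff_ne_zero.2 hε) hεtop : 0 < ε ^ p).ne'
  have h1ε : (1 + ε)⁻¹ < 1 := by
    rw [ENNReal.inv_lt_one]
    exact ENNReal.lt_add_right ENNReal.one_ne_top hε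
  have h1ε0 : (1 + ε)⁻¹ ≠ 0 :=
    ENNReal.inv_ne_zero.2 (ENNReal.add_ne_top.2 ⟨ENNReal.one_ne_top, hεtop⟩)
  obtain ⟨f, φ, r, hf, hf1, hfE, hfF, hφ, hφle, hφfin, hr, hinc⟩ :=
    exists_lipschitz_potential hE hF hEF hlsc hε (fun x => le_add_self.trans (hle x))
      (fun γ hγ hγ0 h0 h1 => (hug.one_le_lineIntegral hγ hγ0 (huE _ h0) (huF _ h1)).trans
        (γ.lineIntegral_mono fun x => le_self_add.trans (hle x))) h1ε0 h1ε
  refine ⟨f, φ, e, r, hf, hf1, hfE, hfF, hφ, hφfin, hr, hinc, hem, hei, fun x => ?_⟩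
  have := hφle x
  rwa [inv_inv, heq] at this

end Normalized

end Coarea

end

/-! ### The main theorem -/

theorem theorem1p3 {X : Type*} [MetricSpace X] [CompactSpace X] [MeasurableSpace X] [BorelSpace X]
    (N : ℝ) (hN : 1 ≤ N) (hX : Coarea.hausdorff N (Set.univ : Set X) < ∞)
    (p : ℝ) (hp : 1 ≤ p) (q : ℝ≥0∞) (hpq : ENNReal.HolderConjugate (ENNReal.ofReal p) q)
    (E F : Set X) (hE : IsCompact E) (hE' : IsConnected E) (hF : IsCompact F) (hF' : IsConnected F)
    (hEF : Disjoint E F)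
    (u : X → EReal) (hu : Coarea.MemNewtonian N p u)
    (huE : ∀ x ∈ E, u x = 0) (huF : ∀ x ∈ F, u x = 1) :
    -- the minimal weak upper gradient exists
    (∃ g : X → ℝ≥0∞, Coarea.IsMinimalWeakUpperGradient N p u g) ∧
    ∃ v : ℕ → X → ℝ,
      (∀ i, (∃ K, LipschitzWith K (v i)) ∧
        Coarea.MemNewtonian N p (fun x => (v i x : EReal)) ∧
        (∀ x ∈ E, v i x = 0) ∧ (∀ x ∈ F, v i x = 1)) ∧
      ∀ ρ : X → ℝ≥0∞, Measurable ρ → eLpNorm ρ q (Coarea.hausdorff N) < ∞ →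
        -- the outer integrand below is measurable, so that the integral over `t` makes sense
        (∀ i, AEMeasurable
          (fun t : ℝ => ∫⁻ x in frontier {y | v i y < t}, ρ x ∂(Coarea.hausdorff (N - 1)))
          (volume.restrict (Icc 0 1))) ∧
        ∀ g : X → ℝ≥0∞, Coarea.IsMinimalWeakUpperGradient N p u g →
          limsup (fun i => ∫⁻ t in Icc (0 : ℝ) 1,
              ∫⁻ x in frontier {y | v i y < t}, ρ x ∂(Coarea.hausdorff (N - 1))) atTop
            ≤ ENNReal.ofReal (2 * Coarea.ballVol (N - 1) / Coarea.ballVol N) *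
                ∫⁻ x, ρ x * g x ∂(Coarea.hausdorff N) := by
  have hp0 : 0 < p := zero_lt_one.trans_le hp
  have : IsFiniteMeasure (Coarea.hausdorff N : Measure X) := ⟨hX⟩
  obtain ⟨g₀, σ, hmin, hout, hσ⟩ := Coarea.exists_isMinimalWeakUpperGradient hp0 hu
  refine ⟨⟨g₀, hmin⟩, ?_⟩
  let ε : ℕ → ℝ≥0∞ := fun n => ((n : ℝ≥0∞) + 1)⁻¹
  have hε0 : ∀ n, ε n ≠ 0 := fun n =>
    ENNReal.inv_ne_zero.2 (ENNReal.add_ne_top.2 ⟨ENNReal.natCast_ne_top n, ENNReal.one_ne_top⟩)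
  have hεtop : ∀ n, ε n ≠ ∞ := fun n => ENNReal.inv_ne_top.2 (by simp)
  have hεlim : Tendsto ε atTop (𝓝 0) := by
    have := (tendsto_add_atTop_iff_nat 1).2 ENNReal.tendsto_inv_nat_nhds_zero
    simpa [ε] using this
  choose v φ e r hv hv1 hvE hvF hφ hφfin hr hinc hem hei hφle using fun n =>
    Coarea.exists_lipschitz_of_upperGradientOutside hp hX hE.isClosed hF.isClosed hEF huE huF
      hout hmin.2.1 hσ (hε0 n) (hεtop n)
  refine ⟨v, fun i => ⟨hv i, Coarea.memNewtonian_of_lipschitzWith hp0.le (hv i) (hv1 i), hvE i,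
    hvF i⟩, fun ρ hρ hρq => ?_⟩
  have hcoarea := fun i => Coarea.coarea_frontier_hausdorff_le hN hX (hv i) (hφ i) (hφfin i) (hr i)
    (hinc i) hρ
  refine ⟨fun i => (hcoarea i).1.restrict, fun g hg => ?_⟩
  set C := ENNReal.ofReal (2 * Coarea.ballVol (N - 1) / Coarea.ballVol N)
  have hhoelder : ∀ {k : X → ℝ≥0∞}, Measurable k → ∫⁻ x, ρ x * k x ∂(Coarea.hausdorff N) ≤
      eLpNorm ρ q (Coarea.hausdorff N) * (∫⁻ x, k x ^ p ∂(Coarea.hausdorff N)) ^ (1 / p) :=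
    fun hk => Coarea.lintegral_mul_le_eLpNorm_mul hp hpq hρ hk
  have hfinite : ∀ {k : X → ℝ≥0∞}, Measurable k → ∫⁻ x, k x ^ p ∂(Coarea.hausdorff N) < ∞ →
      ∫⁻ x, ρ x * k x ∂(Coarea.hausdorff N) ≠ ∞ := fun hk hk' =>
    ne_top_of_le_ne_top (ENNReal.mul_ne_top hρq.ne
      (ENNReal.rpow_ne_top_of_nonneg (by positivity) hk'.ne)) (hhoelder hk)
  have hσρ := hfinite hout.2.1 hσ
  have h1ρ := hfinite (k := fun _ => 1) measurable_const (by simp)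
  set I := ∫⁻ x, ρ x * g₀ x ∂(Coarea.hausdorff N)
  -- Collects the coefficients of `ε i`: the contributions of `σ`, of the added constant, and of the
  -- Vitali-Carathéodory error after Hölder.
  set D := ∫⁻ x, ρ x * σ x ∂(Coarea.hausdorff N) + ∫⁻ x, ρ x * 1 ∂(Coarea.hausdorff N) +
    eLpNorm ρ q (Coarea.hausdorff N) with hD
  have hDtop : D ≠ ∞ := ENNReal.add_ne_top.2 ⟨ENNReal.add_ne_top.2 ⟨hσρ, h1ρ⟩, hρq.ne⟩
  have hbound : ∀ i, ∫⁻ t in Icc (0 : ℝ) 1,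
      ∫⁻ x in frontier {y | v i y < t}, ρ x ∂(Coarea.hausdorff (N - 1)) ≤
      C * ((1 + ε i) * (I + ε i * D)) := by
    intro i
    refine (setLIntegral_le_lintegral _ _).trans ((hcoarea i).2.trans (mul_le_mul_right ?_ _))
    have he : ∫⁻ x, ρ x * e i x ∂(Coarea.hausdorff N) ≤
        ε i * eLpNorm ρ q (Coarea.hausdorff N) := by
      refine (hhoelder (hem i)).trans ?_
      rw [mul_comm]
      gcongr
      rw [one_div, ENNReal.rpow_inv_le_iff hp0]
      exact hei i
    calc ∫⁻ x, ρ x * φ i x ∂(Coarea.hausdorff N)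
        ≤ ∫⁻ x, (1 + ε i) * (ρ x * g₀ x + (ε i * (ρ x * σ x) + ε i * (ρ x * 1)) + ρ x * e i x)
            ∂(Coarea.hausdorff N) := by
          refine lintegral_mono fun x => (mul_le_mul_right (hφle i x) _).trans (le_of_eq ?_)
          ring
      _ = (1 + ε i) * (I + (ε i * ∫⁻ x, ρ x * σ x ∂(Coarea.hausdorff N) +
            ε i * ∫⁻ x, ρ x * 1 ∂(Coarea.hausdorff N)) +
            ∫⁻ x, ρ x * e i x ∂(Coarea.hausdorff N)) := by
          have m1 := hρ.mul hout.1
          have m2 := (hρ.mul hout.2.1).const_mul (ε i)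
          have m3 : Measurable fun x => ε i * (ρ x * 1) := (hρ.mul_const 1).const_mul (ε i)
          have m4 := hρ.mul (hem i)
          have h1 := lintegral_const_mul (μ := Coarea.hausdorff N) (1 + ε i)
            ((m1.add (m2.add m3)).add m4)
          have h2 := lintegral_add_right (μ := Coarea.hausdorff N)
            (fun x => ρ x * g₀ x + (ε i * (ρ x * σ x) + ε i * (ρ x * 1))) m4
          have h3 := lintegral_add_left (μ := Coarea.hausdorff N) m1
            (fun x => ε i * (ρ x * σ x) + ε i * (ρ x * 1))
          have h4 := lintegral_add_left (μ := Coarea.hausdorff N) m2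
            (fun x => ε i * (ρ x * 1))
          have h5 := lintegral_const_mul (μ := Coarea.hausdorff N) (ε i) (hρ.mul hout.2.1)
          have h6 := lintegral_const_mul (μ := Coarea.hausdorff N) (ε i) (hρ.mul_const 1)
          simp only [Pi.mul_apply, Pi.add_apply] at h1 h2 h3 h4 h5 h6
          rw [h1, h2, h3, h4, h5, h6]
      _ ≤ (1 + ε i) * (I + (ε i * ∫⁻ x, ρ x * σ x ∂(Coarea.hausdorff N) +
            ε i * ∫⁻ x, ρ x * 1 ∂(Coarea.hausdorff N)) +
            ε i * eLpNorm ρ q (Coarea.hausdorff N)) := by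
          gcongr
      _ = _ := by rw [hD]; ring
  have hlim : Tendsto (fun i => C * ((1 + ε i) * (I + ε i * D))) atTop
      (𝓝 (C * ((1 + 0) * (I + 0 * D)))) := by
    refine ENNReal.Tendsto.const_mul (ENNReal.Tendsto.mul (tendsto_const_nhds.add hεlim)
      (Or.inl (by simp)) (tendsto_const_nhds.add
        (ENNReal.Tendsto.mul_const hεlim (Or.inr hDtop))) (Or.inr (by simp)))
      (Or.inr ENNReal.ofReal_ne_top)
  rw [add_zero, one_mul, zero_mul, add_zero] at hlim
  calc _ ≤ limsup (fun i => C * ((1 + ε i) * (I + ε i * D))) atTop :=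
        limsup_le_limsup (Eventually.of_forall hbound)
    _ = C * I := hlim.limsup_eq
    _ ≤ _ := by
        -- The sequence was built from `g₀`; any other representative `g` is almost everywhere at
        -- least `g₀`.
        refine mul_le_mul_right (lintegral_mono_ae ?_) _
        filter_upwards [hmin.ae_le hp hg.1 hg.2.1] with x hx
        gcongr
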